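/- **Setting.** Consider a finite-horizon MDP with a state space $\mathcal X$, a finite nonempty action set $\mathcal Y$ with $A=|\mathcal Y|$, horizon $H$, deterministic transitions $x_{h+1}=P_h(x_h,y_h)$, deterministic rewards $r_h:\mathcal X\times\mathcal Y\to\mathbb R$, an initial state $x_1$ drawn from a discrete distribution (in particular, possibly fixed), and a reference policy $\pi^{\mathrm{ref}}=(\pi^{\mathrm{ref}}_h)_{h\le H}$. For $\eta>0$ the KL-regularized value of a policy $\pi$ is $$V^{\pi,\eta}=\mathbb E_\pi\Big[\sum_{h=1}^H r_h(x_h,y_h)-\eta\,\mathrm{KL}\big(\pi_h(x_h)\,\|\,\pi^{\mathrm{ref}}_h(x_h)\big)\Big].$$ The optimal value is given by the soft Bellman equations $V^{\star,\eta}_{H+1}=0$, $Q^{\star,\eta}_h(x,y)=r_h(x,y)+V^{\star,\eta}_{h+1}(P_h(x,y))$, $V^{\star,\eta}_h(x)=\eta\ln\mathbb E_{y\sim\pi^{\mathrm{ref}}_h(x)}\exp(Q^{\star,\eta}_h(x,y)/\eta)$, and $V^{\star,\eta}=\mathbb E[V^{\star,\eta}_1(x_1)]$. Let $Z^\star_h(x,y)$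 be the law of $\sum_{t\ge h}r_t(x_t,y_t)$ under $\pi^{\mathrm{ref}}$ given $x_h=x$, $y_h=y$. For $Z=(Z_h)$ with $Z_h(x,y)$ a discrete distribution on $[0,1]$, let $\pi^{Z,\eta}_h(y\mid x)\propto\pi^{\mathrm{ref}}_h(y\mid x)\,\mathbb E_{z\sim Z_h(x,y)}[e^{z/\eta}]$. **Algorithm.** Let $\mathcal F$ be a class of such $Z$ with $Z^\star\in\mathcal F$. In iteration $k=1,\dots,K$, an online oracle, given the data of the iterations before $k$ and possibly using its own randomness (of discrete law), outputs $\widehat Z_k\in\mathcal F$ (for $k=1$ a random initialization); put $\pi^k=\pi^{\widehat Z_k,\eta}$. For each $h\in[H]$, independently, one rolls in with $\pi^k$ to $x_{h,k}$, plays $y_{h,k}\sim\mathrm{Unif}(\mathcal Y)$, follows $\pi^{\mathrm{ref}}$ to the end, and records $R_{h,k}=\sum_{t\ge h}r_t$. The oracle has maximum-likelihood regret at most $\mathrm{Reg}_{\mathrm{mle}}(K)$: for any data (with $Z^\star_h(R_{h,k}\mid x_{h,k},y_{h,k})>0$) and any corresponding outputs, $$\sum_{k=1}^K\sum_{h=1}^H\big(\log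 Z^\star_h(R_{h,k}\mid x_{h,k},y_{h,k})-\log\widehat Z_{h,k}(R_{h,k}\mid x_{h,k},y_{h,k})\big)\le\mathrm{Reg}_{\mathrm{mle}}(K),$$ where in particular the likelihoods $\widehat Z_{h,k}(R_{h,k}\mid x_{h,k},y_{h,k})$ are positive. **Claim.** There is a universal constant $C$ such that the following holds. Suppose that the rewards-to-go are Bernoulli, $Z^\star_h(x,y)=\mathrm{Ber}(p_h(x,y))$ for all $h\in[H]$, $x$, $y$. Let $\eta\in(0,1]$, $\delta\in(0,1)$ and $\beta=\ln(1/\delta)+\mathrm{Reg}_{\mathrm{mle}}(K)$. Then with probability at least $1-\delta$ $$\sum_{k=1}^K\big(V^{\star,\eta}-V^{\pi^k,\eta}\big)\le C A\Big(\sqrt{\sum_{h=1}^H\sum_{k=1}^K\mathbb E_{x_h\sim\pi^k,\,y_h\sim\mathrm{Unif}(\mathcal Y)}\big[\mathrm{CV}_h(x_h,y_h)^2\big]\,\beta}+\max_{h\in[H]}E_h\,\beta\Big)$$ $$\le C A\Big(\sqrt{\sum_{h=1}^H\sum_{k=1}^K\mathbb E_{x_h\sim\pi^k,\,y_h\sim\mathrm{Unif}(\mathcal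 Y)}\Big[\frac{1-p_h(x_h,y_h)}{p_h(x_h,y_h)}\Big]\,\beta}+\max_{h\in[H]}\Big\|\frac1{p_h(x_h,y_h)}\Big\|_{L_\infty(\pi^{\mathrm{ref}})}\beta\Big),$$ where $\mathrm{CV}_h(x,y)=\sqrt{\mathrm{Var}(e^{Z^\star_h(x,y)/\eta})}\,/\,\mathbb E[e^{Z^\star_h(x,y)/\eta}]$, $E_h=\|\exp((1-Q^{\star,\eta}_h(x_h,y_h))/\eta)\|_{L_\infty(\pi^{\mathrm{ref}})}$, and $1/0=\infty$. The last expression contains no factor that is exponential in $1/\eta$. -/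

import Mathlib

open scoped ENNReal NNReal

noncomputable section

namespace QSharp

/-- Expectation of a real function under a discrete distribution. -/
def expect {α : Type*} (μ : PMF α) (f : α → ℝ) : ℝ := ∑' a, (μ a).toReal * f a

/-- Variance of a real function under a discrete distribution. -/
def variance {α : Type*} (μ : PMF α) (f : α → ℝ) : ℝ :=
  expect μ fun a => (f a - expect μ f) ^ 2

/-- Expectation of a `[0, ∞]`-valued function under a discrete distribution. -/
def eexpect {α : Type*} (μ : PMF α) (f : α → ℝ≥0∞) : ℝ≥0∞ := ∑' a, μ a * f a

/-- The `L_∞(μ)` norm of a `[0, ∞]`-valued function: the essential supremum with respect to a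
discrete distribution is the supremum over its support. -/
def linfNorm {α : Type*} (μ : PMF α) (f : α → ℝ≥0∞) : ℝ≥0∞ := ⨆ a ∈ μ.support, f a

/-- Kullback-Leibler divergence of two distributions on a finite set. It is used only when
`p` is absolutely continuous with respect to `q`, where it is finite. -/
def kl {Y : Type*} [Fintype Y] (p q : PMF Y) : ℝ :=
  ∑ y, (p y).toReal * Real.log ((p y).toReal / (q y).toReal)

/-- The joint law of independent samples from `p 0, …, p (n - 1)`. -/
def indepLaw {D : Type*} (p : ℕ → PMF D) : (n : ℕ) → PMF (Fin n → D)
  | 0 => PMF.pure Fin.elim0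
  | n + 1 => (indepLaw p n).bind fun d => (p n).map fun a => Fin.snoc (α := fun _ => D) d a

/-- A policy: a distribution over actions for every step and state. -/
abbrev Policy (X Y : Type*) := ℕ → X → PMF Y

/-- A model `f = (f_h)` of the reward-to-go, with `f_h(x, y)` a distribution on `[0, 1]`. -/
abbrev Model (X Y : Type*) := ℕ → X → Y → PMF unitInterval

/-- The likelihood `f_h(R ∣ x, y)` that a model gives to a real number `R`. -/
def likelihood {X Y : Type*} (f : Model X Y) (h : ℕ) (x : X) (y : Y) (R : ℝ) : ℝ :=
  ((f h x y).map (Subtype.val : unitInterval → ℝ) R).toReal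

/-- A finite-horizon MDP with deterministic transitions and rewards, together with a reference
policy. Steps are numbered `0, …, H - 1`; the values of the fields at steps `h ≥ H` are
never used. -/
structure DetMDP (X Y : Type*) where
  /-- horizon -/
  H : ℕ
  /-- distribution of the initial state -/
  init : PMF X
  /-- transition function -/
  step : ℕ → X → Y → X
  /-- reward function -/
  reward : ℕ → X → Y → ℝ
  /-- reference policy -/
  ref : Policy X Y

namespace DetMDP

variable {X Y : Type*} (M : DetMDP X Y)

/-- The law of the state `x_h` when the policy `π` is played. -/
def stateLaw (π : Policy X Y) : ℕ → PMF X
  | 0 => M.init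
  | h + 1 => (stateLaw π h).bind fun x => (π h x).map (M.step h x)

/-- The law of `(x_h, y_h)` when the policy `π` is played. -/
def stateActionLaw (π : Policy X Y) (h : ℕ) : PMF (X × Y) :=
  (M.stateLaw π h).bind fun x => (π h x).map fun y => (x, y)

/-- The law of `(x_h, y_h)` when `x_h` is reached by `π` and `y_h` is a uniformly random action. -/
def rollInUnifLaw [Fintype Y] [Nonempty Y] (π : Policy X Y) (h : ℕ) : PMF (X × Y) :=
  (M.stateLaw π h).bind fun x => (PMF.uniformOfFintype Y).map fun y => (x, y)

/-- The law of `∑_{t ≥ h} r_t(x_t, y_t)` under the reference policy started from `x_h = x`. -/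
def refReturn (h : ℕ) (x : X) : PMF ℝ :=
  if h < M.H then
    (M.ref h x).bind fun y =>
      (refReturn (h + 1) (M.step h x y)).map fun z => M.reward h x y + z
  else PMF.pure 0
termination_by M.H - h

/-- The reward-to-go distribution `Z⋆_h(x, y)`: the law of `∑_{t ≥ h} r_t(x_t, y_t)` under the
reference policy, given `x_h = x` and `y_h = y`. -/
def Zstar (h : ℕ) (x : X) (y : Y) : PMF ℝ :=
  (M.refReturn (h + 1) (M.step h x y)).map fun z => M.reward h x y + z

/-- The optimal KL-regularized value function, by the soft Bellman equations. -/
def softV [Fintype Y] (η : ℝ) (h : ℕ) (x : X) : ℝ :=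
  if h < M.H then
    η * Real.log (∑ y, (M.ref h x y).toReal *
      Real.exp ((M.reward h x y + softV η (h + 1) (M.step h x y)) / η))
  else 0
termination_by M.H - h

/-- The optimal KL-regularized action-value function. -/
def softQ [Fintype Y] (η : ℝ) (h : ℕ) (x : X) (y : Y) : ℝ :=
  M.reward h x y + M.softV η (h + 1) (M.step h x y)

/-- The optimal KL-regularized value `V^{⋆,η}`. -/
def optValue [Fintype Y] (η : ℝ) : ℝ := expect M.init (M.softV η 0)

/-- The KL-regularized value `V^{π,η}` of a policy. -/
def value [Fintype Y] (η : ℝ) (π : Policy X Y) : ℝ :=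
  ∑ h ∈ Finset.range M.H, expect (M.stateActionLaw π h) fun xy =>
    M.reward h xy.1 xy.2 - η * kl (π h xy.1) (M.ref h xy.1)

/-- The unnormalized weight `π^ref_h(y ∣ x) · E_{z ∼ Z_h(x,y)} exp(z / η)`. -/
def tiltWeight (η : ℝ) (Z : Model X Y) (h : ℕ) (x : X) (y : Y) : ℝ≥0∞ :=
  M.ref h x y * eexpect (Z h x y) fun z => ENNReal.ofReal (Real.exp ((z : ℝ) / η))

theorem tsum_tiltWeight_ne_zero (η : ℝ) (Z : Model X Y) (h : ℕ) (x : X) :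
    ∑' y, M.tiltWeight η Z h x y ≠ 0 := by
  obtain ⟨y, hy⟩ := (M.ref h x).support_nonempty
  obtain ⟨z, hz⟩ := (Z h x y).support_nonempty
  intro h0
  have h1 := ENNReal.tsum_eq_zero.1 h0 y
  rcases mul_eq_zero.1 h1 with h2 | h2
  · exact hy h2
  · rcases mul_eq_zero.1 (ENNReal.tsum_eq_zero.1 h2 z) with h3 | h3
    · exact hz h3
    · exact absurd (ENNReal.ofReal_eq_zero.1 h3) (not_le.2 (Real.exp_pos _))

theorem tsum_tiltWeight_ne_top (η : ℝ) (Z : Model X Y) (h : ℕ) (x : X) :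
    ∑' y, M.tiltWeight η Z h x y ≠ ∞ := by
  have hb : ∀ y, M.tiltWeight η Z h x y ≤ M.ref h x y * ENNReal.ofReal (Real.exp |1 / η|) := by
    intro y
    refine mul_le_mul_right ?_ _
    calc eexpect (Z h x y) (fun z => ENNReal.ofReal (Real.exp ((z : ℝ) / η)))
        ≤ ∑' z, Z h x y z * ENNReal.ofReal (Real.exp |1 / η|) := by
          refine ENNReal.tsum_le_tsum fun z => mul_le_mul_right ?_ _
          refine ENNReal.ofReal_le_ofReal (Real.exp_le_exp.2 ?_)
          calc (z : ℝ) / η ≤ |(z : ℝ) / η| := le_abs_self _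
            _ = (z : ℝ) * |1 / η| := by
              rw [div_eq_mul_one_div, abs_mul, abs_of_nonneg z.2.1]
            _ ≤ |1 / η| := mul_le_of_le_one_left (abs_nonneg _) z.2.2
      _ = ENNReal.ofReal (Real.exp |1 / η|) := by
          rw [ENNReal.tsum_mul_right, (Z h x y).tsum_coe, one_mul]
  refine ne_top_of_le_ne_top ?_ (ENNReal.tsum_le_tsum hb)
  rw [ENNReal.tsum_mul_right, (M.ref h x).tsum_coe, one_mul]
  exact ENNReal.ofReal_ne_top

/-- The policy `π^{Z,η}_h(y ∣ x) ∝ π^ref_h(y ∣ x) · E_{z ∼ Z_h(x,y)} exp(z / η)`. -/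
def tiltedPolicy (η : ℝ) (Z : Model X Y) : Policy X Y := fun h x =>
  PMF.normalize (M.tiltWeight η Z h x) (M.tsum_tiltWeight_ne_zero η Z h x)
    (M.tsum_tiltWeight_ne_top η Z h x)

/-- The data `(x_h, y_h, R_h)` of one trajectory: roll in with `π` to `x_h`, play a uniformly
random `y_h`, follow the reference policy to the end, and let `R_h = ∑_{t ≥ h} r_t`. -/
def sampleLaw [Fintype Y] [Nonempty Y] (π : Policy X Y) (h : ℕ) : PMF (X × Y × ℝ) :=
  (M.rollInUnifLaw π h).bind fun xy => (M.Zstar h xy.1 xy.2).map fun R => (xy.1, xy.2, R)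

/-- The record of one iteration: the model `Ẑ_k`, and one data point for each step `h`. -/
abbrev Iteration (M : DetMDP X Y) := Model X Y × (Fin M.H → X × Y × ℝ)

/-- An online learner: the (possibly randomized) next model, given the previous iterations.
At the start (empty past) it is the random initialization. -/
abbrev Oracle (M : DetMDP X Y) := (k : ℕ) → (Fin k → M.Iteration) → PMF (Model X Y)

/-- The law of the first `k` iterations of the algorithm. In each one the learner
gives `Ẑ`, and for every step `h < H` an independent trajectory is sampled with `π^{Ẑ,η}`. -/
def runLaw [Fintype Y] [Nonempty Y] (η : ℝ) (O : M.Oracle) : (k : ℕ) → PMF (Fin k → M.Iteration)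
  | 0 => PMF.pure Fin.elim0
  | k + 1 => (runLaw η O k).bind fun past => (O k past).bind fun Z =>
      (indepLaw (M.sampleLaw (M.tiltedPolicy η Z)) M.H).map fun d =>
        Fin.snoc (α := fun _ => M.Iteration) past (Z, d)

/-- `Z⋆ ∈ F`. -/
def Realizable (F : Set (Model X Y)) : Prop :=
  ∃ f ∈ F, ∀ h < M.H, ∀ x y, (f h x y).map (Subtype.val : unitInterval → ℝ) = M.Zstar h x y

/-- `O` is an online oracle for the maximum likelihood loss, with values in `F` and with regret
at most `Reg` after `K` iterations: for any data whatsoever (with `R_{h,k}` a possible value of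
`Z⋆_h(x_{h,k}, y_{h,k})`, so that `log Z⋆_h(R_{h,k} ∣ x_{h,k}, y_{h,k})` is finite) and any outputs
of the oracle along these data, the log-likelihoods of the outputs are finite and
`∑_k ∑_h (log Z⋆_h(R_{h,k} ∣ x_{h,k}, y_{h,k}) - log Ẑ_{h,k}(R_{h,k} ∣ x_{h,k}, y_{h,k})) ≤ Reg`. -/
def IsMLEOracle (F : Set (Model X Y)) (K : ℕ) (Reg : ℝ) (O : M.Oracle) : Prop :=
  (∀ k past, (O k past).support ⊆ F) ∧
  ∀ run : Fin K → M.Iteration,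
    (∀ k : Fin K, (run k).1 ∈ (O k fun i => run (Fin.castLE k.2.le i)).support) →
    (∀ (k : Fin K) (h : Fin M.H), ((run k).2 h).2.2 ∈
      (M.Zstar h ((run k).2 h).1 ((run k).2 h).2.1).support) →
    (∀ (k : Fin K) (h : Fin M.H),
      0 < likelihood (run k).1 h ((run k).2 h).1 ((run k).2 h).2.1 ((run k).2 h).2.2) ∧
    ∑ k : Fin K, ∑ h : Fin M.H,
      (Real.log (M.Zstar h ((run k).2 h).1 ((run k).2 h).2.1 ((run k).2 h).2.2).toReal -
        Real.log (likelihood (run k).1 h ((run k).2 h).1 ((run k).2 h).2.1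
          ((run k).2 h).2.2)) ≤ Reg

/-- The coefficient of variation of `exp(Z⋆_h(x, y) / η)`. -/
def cv (η : ℝ) (h : ℕ) (x : X) (y : Y) : ℝ :=
  √(variance (M.Zstar h x y) fun z => Real.exp (z / η)) /
    expect (M.Zstar h x y) fun z => Real.exp (z / η)

/-- The envelope `‖exp((1 - Q^{⋆,η}_h(x_h, y_h)) / η)‖_{L_∞(π^ref)}`. -/
def envelope [Fintype Y] (η : ℝ) (h : ℕ) : ℝ≥0∞ :=
  linfNorm (M.stateActionLaw M.ref h) fun xy =>
    ENNReal.ofReal (Real.exp ((1 - M.softQ η h xy.1 xy.2) / η))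

/-- The second-order bound
`A (√(∑_h ∑_k E_{x_h ∼ π^k, y_h ∼ Unif}[CV²] · β) + max_h E_h · β)`, for rewards-to-go
in `[0, 1]`. -/
def cvBound [Fintype Y] [Nonempty Y] (η β : ℝ) {K : ℕ} (π : Fin K → Policy X Y) : ℝ≥0∞ :=
  (Fintype.card Y : ℝ≥0∞) *
    (((∑ h ∈ Finset.range M.H, ∑ k, eexpect (M.rollInUnifLaw (π k) h) fun xy =>
          ENNReal.ofReal (M.cv η h xy.1 xy.2 ^ 2)) * ENNReal.ofReal β) ^ (1 / 2 : ℝ) +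
      (⨆ h ∈ Finset.range M.H, M.envelope η h) * ENNReal.ofReal β)

/-- The Bernoulli bound
`A (√(∑_h ∑_k E_{x_h ∼ π^k, y_h ∼ Unif}[(1 - p_h) / p_h] · β) + max_h ‖1 / p_h‖_{L_∞(π^ref)} · β)`,
where `1 / 0 = ∞`. -/
def bernoulliBound [Fintype Y] [Nonempty Y] (p : ℕ → X → Y → unitInterval) (β : ℝ) {K : ℕ}
    (π : Fin K → Policy X Y) : ℝ≥0∞ :=
  (Fintype.card Y : ℝ≥0∞) *
    (((∑ h ∈ Finset.range M.H, ∑ k, eexpect (M.rollInUnifLaw (π k) h) fun xy =>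
          ENNReal.ofReal (1 - (p h xy.1 xy.2 : ℝ)) / ENNReal.ofReal (p h xy.1 xy.2 : ℝ)) *
        ENNReal.ofReal β) ^ (1 / 2 : ℝ) +
      (⨆ h ∈ Finset.range M.H, linfNorm (M.stateActionLaw M.ref h) fun xy =>
          1 / ENNReal.ofReal (p h xy.1 xy.2 : ℝ)) * ENNReal.ofReal β)

end DetMDP

end QSharp

end

/-!
Acting by `π` at step `h` only costs `stepGap`, and the regret of `π` is the sum over `h` of its
means along `π` (performance difference). For a tilted policy the gap at `x` is a difference of
logarithms of exponential moments, hence at most a constant times the sum over `y` of the relative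
errors of the moments `E exp (Z_h(x, y) / η)`. Since `z ↦ exp (z / η)` has values in
`[0, exp (1 / η)]`, writing `q - p = (√q - √p) (2 √p + (√q - √p))` bounds such an error by
`2 CV · D + exp ((1 - Q) / η) · D²`, where `D² = ∑ (√p - √q)²` for the truth `p` and the model `q`.
By Cauchy–Schwarz, everything is controlled by the sum of `D²` over all iterations and steps.

A likelihood ratio has a square root of mean `1 - D² / 2 ≤ exp (-D² / 2)` under the truth, so the
product over the iterations and steps of `√(likelihood ratio) · exp (E[D²] / 2)` is a
supermartingale. Markov's inequality, together with the bound on the log-likelihood regret, turns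
this into `∑ E[D²] ≤ 2 log (1 / δ) + Reg` with probability `1 - δ`.

For returns in `[0, 1]` which equal `1` with probability at least `p`, one has
`exp (Q / η) ≥ p exp (1 / η)`, which bounds the envelope by `1 / p`, and
`Var ≤ (exp (1 / η) - mean) · mean`, which bounds `CV²` by `(1 - p) / p`.
-/

namespace QSharp

section Expectation

variable {α β : Type*}

theorem eexpect_bind (μ : PMF α) (κ : α → PMF β) (f : β → ℝ≥0∞) :
    eexpect (μ.bind κ) f = eexpect μ fun a => eexpect (κ a) f := by
  simp only [eexpect, PMF.bind_apply, ← ENNReal.tsum_mul_right, ← ENNReal.tsum_mul_left]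
  rw [ENNReal.tsum_comm]
  simp only [mul_assoc]

theorem eexpect_pure (a : α) (f : α → ℝ≥0∞) : eexpect (PMF.pure a) f = f a := by
  rw [eexpect, tsum_eq_single a fun b hb => by simp [hb]]
  simp

theorem eexpect_map (μ : PMF α) (g : α → β) (f : β → ℝ≥0∞) :
    eexpect (μ.map g) f = eexpect μ fun a => f (g a) := by
  simp only [PMF.map, eexpect_bind, Function.comp_apply, eexpect_pure]

theorem eexpect_mono {μ : PMF α} {f g : α → ℝ≥0∞} (hfg : ∀ a ∈ μ.support, f a ≤ g a) :
    eexpect μ f ≤ eexpect μ g := by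
  refine ENNReal.tsum_le_tsum fun a => ?_
  by_cases ha : μ a = 0
  · simp [ha]
  · exact mul_le_mul_right (hfg a ha) _

theorem eexpect_congr {μ : PMF α} {f g : α → ℝ≥0∞} (hfg : ∀ a ∈ μ.support, f a = g a) :
    eexpect μ f = eexpect μ g :=
  le_antisymm (eexpect_mono fun a ha => (hfg a ha).le) (eexpect_mono fun a ha => (hfg a ha).ge)

theorem eexpect_add (μ : PMF α) (f g : α → ℝ≥0∞) :
    eexpect μ (fun a => f a + g a) = eexpect μ f + eexpect μ g := by
  simp only [eexpect, mul_add, ENNReal.tsum_add]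

theorem eexpect_const (μ : PMF α) (c : ℝ≥0∞) : eexpect μ (fun _ => c) = c := by
  rw [eexpect, ENNReal.tsum_mul_right, μ.tsum_coe, one_mul]

theorem eexpect_const_mul (μ : PMF α) (c : ℝ≥0∞) (f : α → ℝ≥0∞) :
    eexpect μ (fun a => c * f a) = c * eexpect μ f := by
  simp only [eexpect, mul_left_comm _ c, ENNReal.tsum_mul_left]

theorem eexpect_mul_const (μ : PMF α) (c : ℝ≥0∞) (f : α → ℝ≥0∞) :
    eexpect μ (fun a => f a * c) = eexpect μ f * c := by
  simp only [mul_comm _ c, eexpect_const_mul]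

theorem one_sub_mul_eexpect_le_toOuterMeasure (μ : PMF α) (W : α → ℝ≥0∞) (δ : ℝ≥0∞) :
    1 - δ * eexpect μ W ≤ μ.toOuterMeasure {a | W a ≤ δ⁻¹} := by
  have hpoint (a : α) : μ a ≤ {a | W a ≤ δ⁻¹}.indicator μ a + μ a * (δ * W a) := by
    by_cases ha : W a ≤ δ⁻¹
    · rw [Set.indicator_of_mem (by exact ha)]
      exact le_self_add
    · rw [Set.indicator_of_notMem (by exact ha), zero_add]
      rw [ENNReal.le_inv_iff_mul_le, not_le, mul_comm] at ha
      exact le_mul_of_one_le_right' ha.le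
  rw [tsub_le_iff_right, ← eexpect_const_mul, PMF.toOuterMeasure_apply, eexpect,
    ← ENNReal.tsum_add, ← μ.tsum_coe]
  exact ENNReal.tsum_le_tsum hpoint

/-- Expectations of real functions are given by absolutely convergent sums. -/
def HasExpectation (μ : PMF α) (f : α → ℝ) : Prop := Summable fun a => (μ a).toReal * f a

theorem summable_toReal (μ : PMF α) : Summable fun a => (μ a).toReal :=
  ENNReal.summable_toReal μ.tsum_coe_ne_top

theorem tsum_toReal (μ : PMF α) : ∑' a, (μ a).toReal = 1 := by
  rw [← ENNReal.tsum_toReal_eq μ.apply_ne_top, μ.tsum_coe, ENNReal.toReal_one]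

theorem HasExpectation.of_abs_le {μ : PMF α} {f : α → ℝ} {B : ℝ}
    (hf : ∀ a ∈ μ.support, |f a| ≤ B) : HasExpectation μ f := by
  refine Summable.of_norm_bounded ((summable_toReal μ).mul_right B) fun a => ?_
  rw [norm_mul, Real.norm_of_nonneg ENNReal.toReal_nonneg, Real.norm_eq_abs]
  by_cases ha : μ a = 0
  · simp [ha]
  · exact mul_le_mul_of_nonneg_left (hf a ha) ENNReal.toReal_nonneg

theorem HasExpectation.of_mem_Icc {μ : PMF α} {f : α → ℝ} {a b : ℝ}
    (hf : ∀ x ∈ μ.support, f x ∈ Set.Icc a b) : HasExpectation μ f :=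
  .of_abs_le fun x hx => abs_le_max_abs_abs (hf x hx).1 (hf x hx).2

theorem HasExpectation.const (μ : PMF α) (c : ℝ) : HasExpectation μ fun _ => c :=
  .of_abs_le fun _ _ => le_rfl

theorem HasExpectation.of_finite [Finite α] (μ : PMF α) (f : α → ℝ) : HasExpectation μ f :=
  Summable.of_finite

theorem HasExpectation.add {μ : PMF α} {f g : α → ℝ} (hf : HasExpectation μ f)
    (hg : HasExpectation μ g) : HasExpectation μ fun a => f a + g a := by
  simpa only [HasExpectation, mul_add] using Summable.add hf hg

theorem HasExpectation.sub {μ : PMF α} {f g : α → ℝ} (hf : HasExpectation μ f)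
    (hg : HasExpectation μ g) : HasExpectation μ fun a => f a - g a := by
  simpa only [HasExpectation, mul_sub] using Summable.sub hf hg

theorem HasExpectation.const_mul {μ : PMF α} {f : α → ℝ} (c : ℝ) (hf : HasExpectation μ f) :
    HasExpectation μ fun a => c * f a := by
  simpa only [HasExpectation, mul_left_comm] using Summable.mul_left c hf

theorem expect_const (μ : PMF α) (c : ℝ) : expect μ (fun _ => c) = c := by
  rw [expect, tsum_mul_right, tsum_toReal, one_mul]

theorem expect_add {μ : PMF α} {f g : α → ℝ} (hf : HasExpectation μ f)
    (hg : HasExpectation μ g) : expect μ (fun a => f a + g a) = expect μ f + expect μ g := by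
  simpa only [expect, mul_add] using Summable.tsum_add hf hg

theorem expect_sub {μ : PMF α} {f g : α → ℝ} (hf : HasExpectation μ f)
    (hg : HasExpectation μ g) : expect μ (fun a => f a - g a) = expect μ f - expect μ g := by
  simpa only [expect, mul_sub] using Summable.tsum_sub hf hg

theorem expect_const_mul (μ : PMF α) (c : ℝ) (f : α → ℝ) :
    expect μ (fun a => c * f a) = c * expect μ f := by
  simp only [expect, mul_left_comm _ c, tsum_mul_left]

theorem expect_congr {μ : PMF α} {f g : α → ℝ} (hfg : ∀ a ∈ μ.support, f a = g a) :
    expect μ f = expect μ g := by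
  refine tsum_congr fun a => ?_
  by_cases ha : μ a = 0
  · simp [ha]
  · rw [hfg a ha]

theorem expect_mono {μ : PMF α} {f g : α → ℝ} (hf : HasExpectation μ f)
    (hg : HasExpectation μ g) (hfg : ∀ a ∈ μ.support, f a ≤ g a) : expect μ f ≤ expect μ g := by
  refine Summable.tsum_le_tsum (fun a => ?_) hf hg
  by_cases ha : μ a = 0
  · simp [ha]
  · exact mul_le_mul_of_nonneg_left (hfg a ha) ENNReal.toReal_nonneg

theorem expect_mem_Icc {μ : PMF α} {f : α → ℝ} {a b : ℝ}
    (hf : ∀ x ∈ μ.support, f x ∈ Set.Icc a b) : expect μ f ∈ Set.Icc a b :=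
  ⟨(expect_const μ a).symm.trans_le
      (expect_mono (.const μ a) (.of_mem_Icc hf) fun x hx => (hf x hx).1),
    (expect_mono (.of_mem_Icc hf) (.const μ b) fun x hx => (hf x hx).2).trans_eq (expect_const μ b)⟩

theorem expect_fintype [Fintype α] (μ : PMF α) (f : α → ℝ) :
    expect μ f = ∑ a, (μ a).toReal * f a := tsum_fintype _

theorem ofReal_expect {μ : PMF α} {f : α → ℝ} (hf : HasExpectation μ f)
    (hf0 : ∀ a ∈ μ.support, 0 ≤ f a) :
    ENNReal.ofReal (expect μ f) = eexpect μ fun a => ENNReal.ofReal (f a) := by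
  have h0 (a : α) : 0 ≤ (μ a).toReal * f a := by
    by_cases ha : μ a = 0
    · simp [ha]
    · exact mul_nonneg ENNReal.toReal_nonneg (hf0 a ha)
  rw [expect, ENNReal.ofReal_tsum_of_nonneg h0 hf]
  refine tsum_congr fun a => ?_
  rw [ENNReal.ofReal_mul ENNReal.toReal_nonneg, ENNReal.ofReal_toReal (μ.apply_ne_top a)]

theorem ofReal_expect_le {μ : PMF α} {f : α → ℝ} (hf : HasExpectation μ f) :
    ENNReal.ofReal (expect μ f) ≤ eexpect μ fun a => ENNReal.ofReal (f a) := by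
  have hmax : HasExpectation μ fun a => max (f a) 0 := by
    refine Summable.of_norm_bounded (Summable.norm hf) fun a => ?_
    simp only [norm_mul, Real.norm_eq_abs, abs_of_nonneg (le_max_right (f a) 0)]
    gcongr
    exact max_le (le_abs_self _) (abs_nonneg _)
  calc ENNReal.ofReal (expect μ f) ≤ ENNReal.ofReal (expect μ fun a => max (f a) 0) :=
        ENNReal.ofReal_le_ofReal (expect_mono hf hmax fun a _ => le_max_left _ _)
    _ = eexpect μ fun a => ENNReal.ofReal (max (f a) 0) :=
        ofReal_expect hmax fun a _ => le_max_right _ _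
    _ = _ := by simp [ENNReal.ofReal_max]

theorem expect_pure (a : α) (f : α → ℝ) : expect (PMF.pure a) f = f a := by
  rw [expect, tsum_eq_single a fun b hb => by simp [hb]]
  simp

theorem expect_bind {μ : PMF α} {κ : α → PMF β} {f : β → ℝ} (hf : HasExpectation (μ.bind κ) f) :
    expect (μ.bind κ) f = expect μ fun a => expect (κ a) f := by
  have hterm (b : β) : (μ.bind κ b).toReal * f b =
      ∑' a, (μ a).toReal * (κ a b).toReal * f b := by
    rw [PMF.bind_apply, ENNReal.tsum_toReal_eq fun a =>
      ENNReal.mul_ne_top (μ.apply_ne_top a) ((κ a).apply_ne_top b), ← tsum_mul_right]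
    simp only [ENNReal.toReal_mul]
  have henorm (b : β) : ‖(μ.bind κ b).toReal * f b‖ₑ =
      ∑' a, ‖(μ a).toReal * (κ a b).toReal * f b‖ₑ := by
    simp only [enorm_mul, Real.enorm_of_nonneg ENNReal.toReal_nonneg,
      ENNReal.ofReal_toReal (PMF.apply_ne_top _ _), ENNReal.tsum_mul_right, ← PMF.bind_apply]
  have hsum : Summable (Function.uncurry fun b a => (μ a).toReal * (κ a b).toReal * f b) := by
    refine Summable.of_enorm ?_
    have : ∑' b, ‖(μ.bind κ b).toReal * f b‖ₑ ≠ ∞ :=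
      tsum_enorm_ne_top_iff_summable_norm.2 (Summable.norm hf)
    simp only [henorm] at this
    rwa [← ENNReal.tsum_prod] at this
  calc expect (μ.bind κ) f = ∑' (b) (a), (μ a).toReal * (κ a b).toReal * f b := tsum_congr hterm
    _ = ∑' (a) (b), (μ a).toReal * (κ a b).toReal * f b := hsum.tsum_comm.symm
    _ = _ := by simp only [expect, mul_assoc, tsum_mul_left]

theorem expect_map {μ : PMF α} {g : α → β} {f : β → ℝ} (hf : HasExpectation (μ.map g) f) :
    expect (μ.map g) f = expect μ fun a => f (g a) := by
  rw [PMF.map, expect_bind hf]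
  simp only [Function.comp_apply, expect_pure]

end Expectation

section CauchySchwarz

variable {α : Type*}

theorem tsum_mul_le_rpow_mul_rpow (f g : α → ℝ≥0∞) :
    ∑' a, f a * g a ≤ (∑' a, f a ^ 2) ^ (1 / 2 : ℝ) * (∑' a, g a ^ 2) ^ (1 / 2 : ℝ) := by
  let _ : MeasurableSpace α := ⊤
  simpa only [Pi.mul_apply, MeasureTheory.lintegral_count' measurable_from_top, ENNReal.rpow_two]
    using ENNReal.lintegral_mul_le_Lp_mul_Lq MeasureTheory.Measure.count
      (Real.HolderConjugate.two_two) (f := f) (g := g)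
      measurable_from_top.aemeasurable measurable_from_top.aemeasurable

theorem eexpect_mul_le_rpow_mul_rpow (μ : PMF α) (f g : α → ℝ≥0∞) :
    eexpect μ (fun a => f a * g a) ≤
      eexpect μ (fun a => f a ^ 2) ^ (1 / 2 : ℝ) * eexpect μ (fun a => g a ^ 2) ^ (1 / 2 : ℝ) := by
  have hsqrt (a : α) : μ a ^ (1 / 2 : ℝ) * μ a ^ (1 / 2 : ℝ) = μ a := by
    rw [← ENNReal.rpow_add_of_nonneg _ _ (by norm_num) (by norm_num), add_halves, ENNReal.rpow_one]
  simpa only [eexpect, mul_mul_mul_comm _ (f _), mul_pow, sq (_ ^ (1 / 2 : ℝ)), hsqrt] using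
    tsum_mul_le_rpow_mul_rpow (fun a => μ a ^ (1 / 2 : ℝ) * f a) fun a => μ a ^ (1 / 2 : ℝ) * g a

theorem sum_rpow_mul_rpow_le {ι : Type*} (s : Finset ι) (f g : ι → ℝ≥0∞) :
    ∑ i ∈ s, f i ^ (1 / 2 : ℝ) * g i ^ (1 / 2 : ℝ) ≤
      (∑ i ∈ s, f i) ^ (1 / 2 : ℝ) * (∑ i ∈ s, g i) ^ (1 / 2 : ℝ) := by
  simpa only [← ENNReal.rpow_mul, div_mul_cancel₀ (1 : ℝ) two_ne_zero, ENNReal.rpow_one] using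
    ENNReal.inner_le_Lp_mul_Lq s (fun i => f i ^ (1 / 2 : ℝ)) (fun i => g i ^ (1 / 2 : ℝ))
      Real.HolderConjugate.two_two

end CauchySchwarz

section Variance

variable {α : Type*} {μ : PMF α} {f : α → ℝ}

theorem variance_nonneg (μ : PMF α) (f : α → ℝ) : 0 ≤ variance μ f :=
  tsum_nonneg fun _ => mul_nonneg ENNReal.toReal_nonneg (sq_nonneg _)

theorem variance_le_sub_expect_mul_expect {B : ℝ} (hf : ∀ a ∈ μ.support, f a ∈ Set.Icc 0 B) :
    variance μ f ≤ (B - expect μ f) * expect μ f := by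
  have hfi : HasExpectation μ f := .of_mem_Icc hf
  have hmean := expect_mem_Icc hf
  have hdev (a) (ha : a ∈ μ.support) : |f a - expect μ f| ≤ B :=
    abs_sub_le_of_nonneg_of_le (hf a ha).1 (hf a ha).2 hmean.1 hmean.2
  calc variance μ f
    _ ≤ expect μ fun a => (B - 2 * expect μ f) * f a + expect μ f ^ 2 := by
        refine expect_mono (.of_abs_le (B := B ^ 2) fun a ha => ?_)
          ((hfi.const_mul _).add (.const μ _)) fun a ha => ?_
        · rw [abs_pow]
          exact pow_le_pow_left₀ (abs_nonneg _) (hdev a ha) 2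
        · nlinarith [mul_nonneg (hf a ha).1 (sub_nonneg.2 (hf a ha).2)]
    _ = (B - expect μ f) * expect μ f := by
        rw [expect_add (hfi.const_mul _) (.const μ _), expect_const_mul, expect_const]
        ring

theorem ofReal_variance {B : ℝ} (hf : ∀ a ∈ μ.support, |f a - expect μ f| ≤ B) :
    ENNReal.ofReal (variance μ f) = eexpect μ fun a => ‖f a - expect μ f‖ₑ ^ 2 := by
  rw [variance, ofReal_expect (.of_abs_le (B := B ^ 2) fun a ha => ?_) fun a _ => sq_nonneg _]
  · simp only [Real.enorm_eq_ofReal_abs, ← ENNReal.ofReal_pow (abs_nonneg _), sq_abs]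
  · rw [abs_pow]
    exact pow_le_pow_left₀ (abs_nonneg _) (hf a ha) 2

end Variance

section Hellinger

variable {α : Type*} {p q : PMF α}

/-- Twice the squared Hellinger distance of two discrete distributions; this normalization omits
the factor `1 / 2`. -/
noncomputable def hellingerSq (p q : PMF α) : ℝ≥0∞ :=
  ∑' a, ENNReal.ofReal ((√(p a).toReal - √(q a).toReal) ^ 2)

theorem two_mul_mul_sqrt_div_add_sq {a b : ℝ} (ha : 0 ≤ a) (hb : 0 ≤ b) :
    2 * (a * √(b / a)) + (√a - √b) ^ 2 = a + b := by
  have hmul : a * √(b / a) = √a * √b := by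
    rw [Real.sqrt_div hb, mul_div_left_comm, Real.div_sqrt, mul_comm]
  linear_combination 2 * hmul + Real.sq_sqrt ha + Real.sq_sqrt hb

theorem two_mul_eexpect_sqrt_div_add_hellingerSq (p q : PMF α) :
    2 * (eexpect p fun a => ENNReal.ofReal √((q a).toReal / (p a).toReal)) + hellingerSq p q =
      2 := by
  have hpoint (a : α) : 2 * (p a * ENNReal.ofReal √((q a).toReal / (p a).toReal)) +
      ENNReal.ofReal ((√(p a).toReal - √(q a).toReal) ^ 2) = p a + q a := by
    have hp : 0 ≤ (p a).toReal := ENNReal.toReal_nonneg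
    have hq : 0 ≤ (q a).toReal := ENNReal.toReal_nonneg
    have h := congrArg ENNReal.ofReal (two_mul_mul_sqrt_div_add_sq hp hq)
    rwa [ENNReal.ofReal_add (by positivity) (by positivity), ENNReal.ofReal_mul zero_le_two,
      ENNReal.ofReal_mul hp, ENNReal.ofReal_add hp hq, ENNReal.ofReal_ofNat,
      ENNReal.ofReal_toReal (p.apply_ne_top a), ENNReal.ofReal_toReal (q.apply_ne_top a)] at h
  rw [eexpect, hellingerSq, ← ENNReal.tsum_mul_left, ← ENNReal.tsum_add, tsum_congr hpoint,
    ENNReal.tsum_add, p.tsum_coe, q.tsum_coe, one_add_one_eq_two]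

theorem hellingerSq_le_two (p q : PMF α) : hellingerSq p q ≤ 2 :=
  le_add_self.trans (two_mul_eexpect_sqrt_div_add_hellingerSq p q).le

theorem abs_sub_le_sqrt_mul_abs_add_sq {a b : ℝ} (ha : 0 ≤ a) (hb : 0 ≤ b) :
    |b - a| ≤ 2 * (√a * |√a - √b|) + (√a - √b) ^ 2 := by
  have hdecomp : b - a = -(2 * (√a * (√a - √b))) + (√a - √b) ^ 2 := by
    linear_combination Real.sq_sqrt ha - Real.sq_sqrt hb
  calc |b - a| ≤ |-(2 * (√a * (√a - √b)))| + |(√a - √b) ^ 2| := hdecomp ▸ abs_add_le _ _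
    _ = _ := by rw [abs_neg, abs_mul, abs_mul, abs_two, abs_of_nonneg (Real.sqrt_nonneg a), abs_sq]

theorem enorm_expect_sub_expect_le_tsum {f : α → ℝ} (hp : HasExpectation p f)
    (hq : HasExpectation q f) :
    ‖expect q f - expect p f‖ₑ ≤ ∑' a, ‖(q a).toReal - (p a).toReal‖ₑ * ‖f a‖ₑ := by
  rw [expect, expect, ← Summable.tsum_sub hq hp]
  simp only [← sub_mul, ← enorm_mul]
  exact enorm_tsum_le_tsum_enorm

theorem enorm_expect_sub_expect_le {f : α → ℝ} {B : ℝ} (hp : ∀ a ∈ p.support, |f a| ≤ B)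
    (hq : ∀ a ∈ q.support, |f a| ≤ B) :
    ‖expect q f - expect p f‖ₑ ≤
      2 * (eexpect p (fun a => ‖f a‖ₑ ^ 2) ^ (1 / 2 : ℝ) * hellingerSq p q ^ (1 / 2 : ℝ)) +
        ENNReal.ofReal B * hellingerSq p q := by
  have hpoint (a : α) : ‖(q a).toReal - (p a).toReal‖ₑ * ‖f a‖ₑ ≤
      2 * ((ENNReal.ofReal √(p a).toReal * ‖f a‖ₑ) * ‖√(p a).toReal - √(q a).toReal‖ₑ) +
        ENNReal.ofReal B * ENNReal.ofReal ((√(p a).toReal - √(q a).toReal) ^ 2) := by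
    by_cases hpq : p a = 0 ∧ q a = 0
    · simp [hpq.1, hpq.2]
    have hfa : ‖f a‖ₑ ≤ ENNReal.ofReal B := by
      rw [Real.enorm_eq_ofReal_abs]
      refine ENNReal.ofReal_le_ofReal ?_
      by_cases hpa : p a = 0
      · exact hq a fun hqa => hpq ⟨hpa, hqa⟩
      · exact hp a hpa
    have hdiff := ENNReal.ofReal_le_ofReal
      (abs_sub_le_sqrt_mul_abs_add_sq (p a).toReal_nonneg (q a).toReal_nonneg)
    rw [ENNReal.ofReal_add (by positivity) (by positivity), ENNReal.ofReal_mul zero_le_two,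
      ENNReal.ofReal_mul (Real.sqrt_nonneg _), ENNReal.ofReal_ofNat, ← Real.enorm_eq_ofReal_abs,
      ← Real.enorm_eq_ofReal_abs] at hdiff
    calc ‖(q a).toReal - (p a).toReal‖ₑ * ‖f a‖ₑ
      _ ≤ (2 * (ENNReal.ofReal √(p a).toReal * ‖√(p a).toReal - √(q a).toReal‖ₑ) +
            ENNReal.ofReal ((√(p a).toReal - √(q a).toReal) ^ 2)) * ‖f a‖ₑ := by gcongr
      _ = 2 * ((ENNReal.ofReal √(p a).toReal * ‖f a‖ₑ) * ‖√(p a).toReal - √(q a).toReal‖ₑ) +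
            ‖f a‖ₑ * ENNReal.ofReal ((√(p a).toReal - √(q a).toReal) ^ 2) := by ring
      _ ≤ _ := by gcongr
  refine (enorm_expect_sub_expect_le_tsum (.of_abs_le hp) (.of_abs_le hq)).trans
    ((ENNReal.tsum_le_tsum hpoint).trans ?_)
  rw [ENNReal.tsum_add, ENNReal.tsum_mul_left, ENNReal.tsum_mul_left, ← hellingerSq]
  gcongr
  refine (tsum_mul_le_rpow_mul_rpow _ _).trans_eq ?_
  simp only [mul_pow, ← ENNReal.ofReal_pow (Real.sqrt_nonneg _),
    Real.sq_sqrt ENNReal.toReal_nonneg, ENNReal.ofReal_toReal (p.apply_ne_top _),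
    Real.enorm_eq_ofReal_abs, ← ENNReal.ofReal_pow (abs_nonneg _), sq_abs, eexpect, hellingerSq]

theorem enorm_expect_sub_expect_le_variance {f : α → ℝ} {B : ℝ}
    (hp : ∀ a ∈ p.support, f a ∈ Set.Icc 0 B) (hq : ∀ a ∈ q.support, f a ∈ Set.Icc 0 B) :
    ‖expect q f - expect p f‖ₑ ≤
      2 * (ENNReal.ofReal √(variance p f) * hellingerSq p q ^ (1 / 2 : ℝ)) +
        ENNReal.ofReal B * hellingerSq p q := by
  have hdev {a : α} (ha : f a ∈ Set.Icc 0 B) : |f a - expect p f| ≤ B :=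
    abs_sub_le_of_nonneg_of_le ha.1 ha.2 (expect_mem_Icc hp).1 (expect_mem_Icc hp).2
  have hcenter {μ : PMF α} (hμ : ∀ a ∈ μ.support, f a ∈ Set.Icc 0 B) :
      expect μ (fun a => f a - expect p f) = expect μ f - expect p f := by
    rw [expect_sub (.of_mem_Icc hμ) (.const _ _), expect_const]
  have h := enorm_expect_sub_expect_le (fun a ha => hdev (hp a ha)) fun a ha => hdev (hq a ha)
  rwa [hcenter hp, hcenter hq, sub_sub_sub_cancel_right,
    ← ofReal_variance fun a ha => hdev (hp a ha),
    ENNReal.ofReal_rpow_of_nonneg (variance_nonneg p f) (by norm_num), ← Real.sqrt_eq_rpow] at h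

end Hellinger

section IndepLaw

variable {D : Type*} (p : ℕ → PMF D)

theorem eexpect_indepLaw_prod (f : ℕ → D → ℝ≥0∞) (n : ℕ) :
    eexpect (indepLaw p n) (fun d => ∏ i : Fin n, f i (d i)) =
      ∏ i : Fin n, eexpect (p i) (f i) := by
  induction n with
  | zero => simp [indepLaw, eexpect_pure]
  | succ n ih =>
    simp only [indepLaw, eexpect_bind, eexpect_map, Fin.prod_univ_castSucc, Fin.snoc_castSucc,
      Fin.snoc_last, Fin.val_castSucc, Fin.val_last, eexpect_const_mul, eexpect_mul_const, ih]

theorem mem_support_of_mem_support_indepLaw {n : ℕ} {d : Fin n → D}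
    (hd : d ∈ (indepLaw p n).support) (i : Fin n) : d i ∈ (p i).support := by
  induction n with
  | zero => exact i.elim0
  | succ n ih =>
    simp only [indepLaw, PMF.mem_support_bind_iff, PMF.mem_support_map_iff] at hd
    obtain ⟨past, hpast, a, ha, rfl⟩ := hd
    refine Fin.lastCases ?_ (fun j => ?_) i
    · rw [Fin.snoc_last]
      exact ha
    · rw [Fin.snoc_castSucc]
      exact ih hpast j

end IndepLaw

/-- The reward-to-go distribution `f_h(x, y)` of a model, as a distribution on the real line. -/
noncomputable def returnLaw {X Y : Type*} (f : Model X Y) (h : ℕ) (x : X) (y : Y) : PMF ℝ :=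
  (f h x y).map Subtype.val

theorem snoc_castLE {α : Type*} {m n : ℕ} (hmn : m ≤ n) (past : Fin n → α) (a : α) :
    (fun j : Fin m => Fin.snoc (α := fun _ => α) past a (Fin.castLE (hmn.trans n.le_succ) j)) =
      fun j => past (Fin.castLE hmn j) :=
  funext fun j => Fin.snoc_castSucc (α := fun _ => α) a past (Fin.castLE hmn j)

namespace DetMDP

section LogLoss

variable {X Y : Type*} (M : DetMDP X Y)

/-- The square root of the ratio of the likelihoods of one data point under the model and under
the truth. -/
noncomputable def sqrtRatio (Z : Model X Y) (h : ℕ) (d : X × Y × ℝ) : ℝ :=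
  √(likelihood Z h d.1 d.2.1 d.2.2 / (M.Zstar h d.1 d.2.1 d.2.2).toReal)

/-- The excess of the log-loss of the model over that of the truth, on the data of one iteration. -/
noncomputable def excessLogLoss (it : M.Iteration) : ℝ :=
  ∑ h : Fin M.H, (Real.log (M.Zstar h (it.2 h).1 (it.2 h).2.1 (it.2 h).2.2).toReal -
    Real.log (likelihood it.1 h (it.2 h).1 (it.2 h).2.1 (it.2 h).2.2))

theorem sqrtRatio_eq_exp {Z : Model X Y} {h : ℕ} {d : X × Y × ℝ}
    (hd : d.2.2 ∈ (M.Zstar h d.1 d.2.1).support)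
    (hZ : 0 < likelihood Z h d.1 d.2.1 d.2.2) :
    M.sqrtRatio Z h d = Real.exp (-(Real.log (M.Zstar h d.1 d.2.1 d.2.2).toReal -
      Real.log (likelihood Z h d.1 d.2.1 d.2.2)) / 2) := by
  have hstar : 0 < (M.Zstar h d.1 d.2.1 d.2.2).toReal :=
    ENNReal.toReal_pos hd (PMF.apply_ne_top _ _)
  rw [neg_sub, ← Real.log_div hZ.ne' hstar.ne', Real.exp_half, Real.exp_log (div_pos hZ hstar),
    sqrtRatio]

end LogLoss

section Likelihood

variable {X Y : Type*} [Fintype Y] [Nonempty Y] (M : DetMDP X Y)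

theorem mem_support_Zstar_of_mem_support_sampleLaw {π : Policy X Y} {h : ℕ} {d : X × Y × ℝ}
    (hd : d ∈ (M.sampleLaw π h).support) : d.2.2 ∈ (M.Zstar h d.1 d.2.1).support := by
  simp only [sampleLaw, PMF.mem_support_bind_iff, PMF.mem_support_map_iff] at hd
  obtain ⟨xy, -, R, hR, rfl⟩ := hd
  exact hR

variable {η : ℝ} {O : M.Oracle}

theorem model_mem_support_of_mem_support_runLaw {k : ℕ} {run : Fin k → M.Iteration}
    (hrun : run ∈ (M.runLaw η O k).support) (i : Fin k) :
    (run i).1 ∈ (O i fun j => run (Fin.castLE i.2.le j)).support := by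
  induction k with
  | zero => exact i.elim0
  | succ k ih =>
    simp only [runLaw, PMF.mem_support_bind_iff, PMF.mem_support_map_iff] at hrun
    obtain ⟨past, hpast, Z, hZ, d, -, rfl⟩ := hrun
    refine Fin.lastCases ?_ (fun j => ?_) i
    · rw [Fin.snoc_last]
      exact (snoc_castLE le_rfl past (Z, d)).symm ▸ hZ
    · rw [Fin.snoc_castSucc]
      exact (snoc_castLE j.2.le past (Z, d)).symm ▸ ih hpast j

theorem return_mem_support_of_mem_support_runLaw {k : ℕ} {run : Fin k → M.Iteration}
    (hrun : run ∈ (M.runLaw η O k).support) (i : Fin k) (h : Fin M.H) :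
    ((run i).2 h).2.2 ∈ (M.Zstar h ((run i).2 h).1 ((run i).2 h).2.1).support := by
  induction k with
  | zero => exact i.elim0
  | succ k ih =>
    simp only [runLaw, PMF.mem_support_bind_iff, PMF.mem_support_map_iff] at hrun
    obtain ⟨past, hpast, Z, -, d, hd, rfl⟩ := hrun
    refine Fin.lastCases ?_ (fun j => ?_) i
    · rw [Fin.snoc_last]
      exact M.mem_support_Zstar_of_mem_support_sampleLaw
        (mem_support_of_mem_support_indepLaw _ hd h)
    · rw [Fin.snoc_castSucc]
      exact ih hpast j

/-- The expected squared Hellinger error of the model `Z` at step `h`, for data collected with the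
roll-in policy `π`. -/
noncomputable def modelError (π : Policy X Y) (Z : Model X Y) (h : ℕ) : ℝ≥0∞ :=
  eexpect (M.rollInUnifLaw π h) fun xy =>
    hellingerSq (M.Zstar h xy.1 xy.2) (returnLaw Z h xy.1 xy.2)

theorem modelError_ne_top (π : Policy X Y) (Z : Model X Y) (h : ℕ) : M.modelError π Z h ≠ ∞ :=
  ne_top_of_le_ne_top ENNReal.ofNat_ne_top <|
    (eexpect_mono fun _ _ => hellingerSq_le_two _ _).trans (eexpect_const _ _).le

theorem two_mul_eexpect_sqrtRatio_add_modelError (π : Policy X Y) (Z : Model X Y) (h : ℕ) :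
    2 * (eexpect (M.sampleLaw π h) fun d => ENNReal.ofReal (M.sqrtRatio Z h d)) +
      M.modelError π Z h = 2 := by
  rw [sampleLaw, eexpect_bind, ← eexpect_const_mul, modelError, ← eexpect_add]
  refine Eq.trans (eexpect_congr fun xy _ => ?_) (eexpect_const (M.rollInUnifLaw π h) 2)
  rw [eexpect_map]
  exact two_mul_eexpect_sqrt_div_add_hellingerSq (M.Zstar h xy.1 xy.2) (returnLaw Z h xy.1 xy.2)

theorem eexpect_sqrtRatio_le_exp (π : Policy X Y) (Z : Model X Y) (h : ℕ) :
    (eexpect (M.sampleLaw π h) fun d => ENNReal.ofReal (M.sqrtRatio Z h d)) ≤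
      ENNReal.ofReal (Real.exp (-((M.modelError π Z h).toReal / 2))) := by
  have hsum := M.two_mul_eexpect_sqrtRatio_add_modelError π Z h
  set b := eexpect (M.sampleLaw π h) fun d => ENNReal.ofReal (M.sqrtRatio Z h d)
  have hb : b ≠ ∞ := by
    rintro hb
    simp [hb] at hsum
  have hreal : 2 * b.toReal + (M.modelError π Z h).toReal = 2 := by
    rw [← ENNReal.toReal_ofNat 2, ← ENNReal.toReal_mul,
      ← ENNReal.toReal_add (ENNReal.mul_ne_top ENNReal.ofNat_ne_top hb) (M.modelError_ne_top π Z h),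
      hsum]
  rw [← ENNReal.ofReal_toReal hb]
  exact ENNReal.ofReal_le_ofReal
    (by linarith [Real.add_one_le_exp (-((M.modelError π Z h).toReal / 2))])

/-- The factor that one iteration contributes to the exponential supermartingale which controls
the cumulative model error. -/
noncomputable def iterationFactor (η : ℝ) (it : M.Iteration) : ℝ≥0∞ :=
  ∏ h : Fin M.H, ENNReal.ofReal (M.sqrtRatio it.1 h (it.2 h)) *
    ENNReal.ofReal (Real.exp ((M.modelError (M.tiltedPolicy η it.1) it.1 h).toReal / 2))

theorem eexpect_iterationFactor_le_one (η : ℝ) (Z : Model X Y) :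
    eexpect (indepLaw (M.sampleLaw (M.tiltedPolicy η Z)) M.H)
      (fun d => M.iterationFactor η (Z, d)) ≤ 1 := by
  refine (eexpect_indepLaw_prod (M.sampleLaw (M.tiltedPolicy η Z))
    (fun h d => ENNReal.ofReal (M.sqrtRatio Z h d) *
      ENNReal.ofReal (Real.exp ((M.modelError (M.tiltedPolicy η Z) Z h).toReal / 2))) M.H).trans_le
    (Finset.prod_le_one' fun h _ => ?_)
  rw [eexpect_mul_const]
  refine (mul_le_mul_left (M.eexpect_sqrtRatio_le_exp _ Z h) _).trans_eq ?_
  rw [← ENNReal.ofReal_mul (Real.exp_pos _).le, ← Real.exp_add, neg_add_cancel, Real.exp_zero,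
    ENNReal.ofReal_one]

theorem eexpect_prod_iterationFactor_le_one (η : ℝ) (O : M.Oracle) (k : ℕ) :
    eexpect (M.runLaw η O k) (fun run => ∏ i, M.iterationFactor η (run i)) ≤ 1 := by
  induction k with
  | zero => simp [runLaw, eexpect_pure]
  | succ k ih =>
    simp only [runLaw, eexpect_bind, eexpect_map, Fin.prod_univ_castSucc, Fin.snoc_castSucc,
      Fin.snoc_last, eexpect_const_mul]
    refine (eexpect_mono fun past _ => mul_le_of_le_one_right' ?_).trans ih
    exact (eexpect_mono fun Z _ => M.eexpect_iterationFactor_le_one η Z).trans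
      (eexpect_const _ 1).le

theorem iterationFactor_eq_exp (η : ℝ) {it : M.Iteration}
    (hit : ∀ h : Fin M.H, (it.2 h).2.2 ∈ (M.Zstar h (it.2 h).1 (it.2 h).2.1).support)
    (hpos : ∀ h : Fin M.H, 0 < likelihood it.1 h (it.2 h).1 (it.2 h).2.1 (it.2 h).2.2) :
    M.iterationFactor η it = ENNReal.ofReal (Real.exp
      ((∑ h : Fin M.H, (M.modelError (M.tiltedPolicy η it.1) it.1 h).toReal -
        M.excessLogLoss it) / 2)) := by
  rw [excessLogLoss, ← Finset.sum_sub_distrib, Finset.sum_div, Real.exp_sum,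
    ENNReal.ofReal_prod_of_nonneg fun _ _ => (Real.exp_pos _).le, iterationFactor]
  refine Finset.prod_congr rfl fun h _ => ?_
  rw [M.sqrtRatio_eq_exp (hit h) (hpos h), ← ENNReal.ofReal_mul (Real.exp_pos _).le, ← Real.exp_add]
  ring_nf

variable {M} {F : Set (Model X Y)} {K : ℕ} {Reg : ℝ}

theorem IsMLEOracle.ofReal_exp_le_prod_iterationFactor (hO : M.IsMLEOracle F K Reg O)
    {run : Fin K → M.Iteration} (hrun : run ∈ (M.runLaw η O K).support) :
    ENNReal.ofReal (Real.exp ((∑ k, ∑ h : Fin M.H,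
      (M.modelError (M.tiltedPolicy η (run k).1) (run k).1 h).toReal - Reg) / 2)) ≤
      ∏ k, M.iterationFactor η (run k) := by
  have hret := M.return_mem_support_of_mem_support_runLaw hrun
  obtain ⟨hpos, hreg⟩ := hO.2 run (M.model_mem_support_of_mem_support_runLaw hrun) hret
  rw [Finset.prod_congr rfl fun k _ => M.iterationFactor_eq_exp η (hret k) (hpos k),
    ← ENNReal.ofReal_prod_of_nonneg fun _ _ => (Real.exp_pos _).le, ← Real.exp_sum,
    ← Finset.sum_div, Finset.sum_sub_distrib]
  gcongr
  exact hreg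

theorem IsMLEOracle.one_sub_le_toOuterMeasure_sum_modelError_le (hO : M.IsMLEOracle F K Reg O)
    (η : ℝ) {δ : ℝ} (hδ : 0 < δ) :
    ENNReal.ofReal (1 - δ) ≤ (M.runLaw η O K).toOuterMeasure {run |
      ∑ k, ∑ h : Fin M.H, M.modelError (M.tiltedPolicy η (run k).1) (run k).1 h ≤
        ENNReal.ofReal (2 * Real.log (1 / δ) + Reg)} := by
  calc ENNReal.ofReal (1 - δ)
    _ ≤ 1 - ENNReal.ofReal δ *
          eexpect (M.runLaw η O K) fun run => ∏ k, M.iterationFactor η (run k) := by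
        rw [ENNReal.ofReal_sub _ hδ.le, ENNReal.ofReal_one]
        exact tsub_le_tsub_left
          (mul_le_of_le_one_right' (M.eexpect_prod_iterationFactor_le_one η O K)) _
    _ ≤ _ := one_sub_mul_eexpect_le_toOuterMeasure _ _ _
    _ ≤ _ := PMF.toOuterMeasure_mono _ ?_
  rintro run ⟨hW, hrun⟩
  have hexp := (hO.ofReal_exp_le_prod_iterationFactor hrun).trans hW
  rw [← ENNReal.ofReal_inv_of_pos hδ, ENNReal.ofReal_le_ofReal_iff (inv_pos.2 hδ).le, ← one_div,
    ← Real.le_log_iff_exp_le (one_div_pos.2 hδ)] at hexp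
  have hfin (k : Fin K) :
      ∑ h : Fin M.H, M.modelError (M.tiltedPolicy η (run k).1) (run k).1 h ≠ ∞ :=
    ENNReal.sum_ne_top.2 fun _ _ => M.modelError_ne_top _ _ _
  rw [Set.mem_ofPred_eq, ← ENNReal.ofReal_toReal (ENNReal.sum_ne_top.2 fun k _ => hfin k)]
  refine ENNReal.ofReal_le_ofReal ?_
  rw [ENNReal.toReal_sum fun k _ => hfin k]
  simp only [ENNReal.toReal_sum fun _ _ => M.modelError_ne_top _ _ _]
  linarith

end Likelihood

theorem IsMLEOracle.regret_nonneg {X Y : Type*} [Finite Y] [Nonempty Y] {M : DetMDP X Y}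
    {F : Set (Model X Y)} {K : ℕ} {Reg : ℝ} {O : M.Oracle} (hO : M.IsMLEOracle F K Reg O) :
    0 ≤ Reg := by
  have := Fintype.ofFinite Y
  have hexp : ENNReal.ofReal (Real.exp (-(Reg / 2))) ≤ 1 := by
    rw [← eexpect_const (M.runLaw 1 O K) (ENNReal.ofReal (Real.exp (-(Reg / 2))))]
    refine (eexpect_mono fun run hrun => ?_).trans (M.eexpect_prod_iterationFactor_le_one 1 O K)
    refine le_trans ?_ (hO.ofReal_exp_le_prod_iterationFactor hrun)
    gcongr
    have : 0 ≤ ∑ k, ∑ h : Fin M.H,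
        (M.modelError (M.tiltedPolicy 1 (run k).1) (run k).1 h).toReal :=
      Finset.sum_nonneg fun _ _ => Finset.sum_nonneg fun _ _ => ENNReal.toReal_nonneg
    linarith
  rw [ENNReal.ofReal_le_one, Real.exp_le_one_iff] at hexp
  linarith

end DetMDP

section Tilting

theorem exp_div_mem_Icc_iff {η : ℝ} (hη : 0 < η) {z : ℝ} :
    Real.exp (z / η) ∈ Set.Icc 1 (Real.exp (1 / η)) ↔ z ∈ Set.Icc 0 1 := by
  rw [Set.mem_Icc, Real.one_le_exp_iff, Real.exp_le_exp, div_le_div_iff_of_pos_right hη,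
    le_div_iff₀ hη, zero_mul, Set.mem_Icc]

theorem neg_log_le_two_mul_abs_sub_one {a : ℝ} (ha : 1 / 2 ≤ a) :
    -Real.log a ≤ 2 * |a - 1| := by
  have ha0 : 0 < a := one_half_pos.trans_le ha
  calc -Real.log a = Real.log a⁻¹ := (Real.log_inv a).symm
    _ ≤ a⁻¹ - 1 := Real.log_le_sub_one_of_pos (inv_pos.2 ha0)
    _ = a⁻¹ * (1 - a) := by rw [mul_sub, mul_one, inv_mul_cancel₀ ha0.ne']
    _ ≤ a⁻¹ * |a - 1| := by
      rw [← neg_sub]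
      gcongr
      exact neg_le_abs _
    _ ≤ 2 * |a - 1| := by
      gcongr
      exact inv_le_of_inv_le₀ two_pos (by rwa [inv_eq_one_div])

theorem mul_neg_log_le {η a : ℝ} (hη : 0 < η) (ha : Real.exp (-(1 / η)) ≤ a) :
    η * -Real.log a ≤ 2 * max 1 η * |a - 1| := by
  rcases le_total (1 / 2) a with ha2 | ha2
  · calc η * -Real.log a ≤ η * (2 * |a - 1|) := by
          gcongr
          exact neg_log_le_two_mul_abs_sub_one ha2
      _ ≤ max 1 η * (2 * |a - 1|) := by
          gcongr
          exact le_max_right _ _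
      _ = 2 * max 1 η * |a - 1| := by ring
  · have hlog : -Real.log a ≤ 1 / η :=
      neg_le.1 ((Real.le_log_iff_exp_le ((Real.exp_pos _).trans_le ha)).2 ha)
    calc η * -Real.log a ≤ η * (1 / η) := by gcongr
      _ = 2 * 1 * (1 / 2) := by rw [mul_one_div_cancel hη.ne']; norm_num
      _ ≤ 2 * max 1 η * |a - 1| := by
        gcongr
        · exact le_max_left _ _
        · exact le_trans (by linarith) (neg_le_abs (a - 1))

variable {ι : Type*} [Fintype ι] {r m n : ι → ℝ}

theorem sum_mul_div_sum_mul_sub_one (hm : ∀ i, m i ≠ 0) (hS : ∑ i, r i * m i ≠ 0) :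
    (∑ i, r i * n i) / (∑ i, r i * m i) - 1 =
      ∑ i, r i * m i / (∑ j, r j * m j) * (n i / m i - 1) := by
  have hterm (i : ι) : r i * m i * (n i / m i - 1) = r i * n i - r i * m i := by
    rw [mul_sub, mul_assoc, mul_div_cancel₀ _ (hm i), mul_one]
  simp only [div_mul_eq_mul_div, ← Finset.sum_div, hterm, Finset.sum_sub_distrib]
  rw [sub_div, div_self hS]

theorem mul_log_sum_sub_log_sum_le {η : ℝ} (hη : 0 < η) (hr : ∀ i, 0 ≤ r i) (hm : ∀ i, 0 < m i)
    (hmn : ∀ i, Real.exp (-(1 / η)) * m i ≤ n i) (hS : 0 < ∑ i, r i * m i) :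
    η * (Real.log (∑ i, r i * m i) - Real.log (∑ i, r i * n i)) ≤
      2 * max 1 η * ∑ i, r i * m i / (∑ j, r j * m j) * |n i / m i - 1| := by
  have hN : Real.exp (-(1 / η)) * ∑ i, r i * m i ≤ ∑ i, r i * n i := by
    rw [Finset.mul_sum]
    refine Finset.sum_le_sum fun i _ => ?_
    rw [mul_left_comm]
    exact mul_le_mul_of_nonneg_left (hmn i) (hr i)
  have hN0 : 0 < ∑ i, r i * n i := (mul_pos (Real.exp_pos _) hS).trans_le hN
  calc η * (Real.log (∑ i, r i * m i) - Real.log (∑ i, r i * n i))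
    _ = η * -Real.log ((∑ i, r i * n i) / ∑ i, r i * m i) := by
        rw [Real.log_div hN0.ne' hS.ne', neg_sub]
    _ ≤ 2 * max 1 η * |(∑ i, r i * n i) / (∑ i, r i * m i) - 1| :=
        mul_neg_log_le hη ((le_div_iff₀ hS).2 hN)
    _ ≤ 2 * max 1 η * ∑ i, r i * m i / (∑ j, r j * m j) * |n i / m i - 1| := by
        rw [sum_mul_div_sum_mul_sub_one (fun i => (hm i).ne') hS.ne']
        gcongr
        refine (Finset.abs_sum_le_sum_abs _ _).trans_eq (Finset.sum_congr rfl fun i _ => ?_)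
        rw [abs_mul, abs_of_nonneg (div_nonneg (mul_nonneg (hr i) (hm i).le) hS.le)]

theorem log_sub_log_le_abs_div_sub_one {a b : ℝ} (ha : 0 < a) (hb : 0 < b) :
    Real.log a - Real.log b ≤ |a / b - 1| := by
  rw [← Real.log_div ha.ne' hb.ne']
  exact (Real.log_le_sub_one_of_pos (div_pos ha hb)).trans (le_abs_self _)

end Tilting

namespace DetMDP

section SoftBellman

variable {X Y : Type*} [Fintype Y] (M : DetMDP X Y)

theorem softV_of_le {η : ℝ} {h : ℕ} (hh : M.H ≤ h) (x : X) : M.softV η h x = 0 := by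
  rw [softV, if_neg hh.not_gt]

theorem exp_softV_of_lt {η : ℝ} (hη : 0 < η) {h : ℕ} (hh : h < M.H) (x : X) :
    Real.exp (M.softV η h x / η) =
      ∑ y, (M.ref h x y).toReal * Real.exp (M.softQ η h x y / η) := by
  rw [softV, if_pos hh, mul_div_cancel_left₀ _ hη.ne', Real.exp_log]
  · rfl
  · obtain ⟨y, hy⟩ := (M.ref h x).support_nonempty
    exact Finset.sum_pos' (fun y _ => mul_nonneg ENNReal.toReal_nonneg (Real.exp_pos _).le)
      ⟨y, Finset.mem_univ y, mul_pos (ENNReal.toReal_pos hy (PMF.apply_ne_top _ _))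
        (Real.exp_pos _)⟩

theorem ofReal_exp_add_div (a b η : ℝ) : ENNReal.ofReal (Real.exp ((a + b) / η)) =
    ENNReal.ofReal (Real.exp (a / η)) * ENNReal.ofReal (Real.exp (b / η)) := by
  rw [add_div, Real.exp_add, ENNReal.ofReal_mul (Real.exp_pos _).le]

theorem ofReal_exp_softV {η : ℝ} (hη : 0 < η) (h : ℕ) (x : X) :
    ENNReal.ofReal (Real.exp (M.softV η h x / η)) =
      eexpect (M.refReturn h x) fun z => ENNReal.ofReal (Real.exp (z / η)) := by
  induction hn : M.H - h generalizing h x with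
  | zero =>
    have hh : M.H ≤ h := by lia
    rw [M.softV_of_le hh, refReturn, if_neg hh.not_gt, eexpect_pure]
  | succ n ih =>
    have hh : h < M.H := by lia
    rw [M.exp_softV_of_lt hη hh, refReturn, if_pos hh, eexpect_bind, eexpect, tsum_fintype,
      ENNReal.ofReal_sum_of_nonneg fun y _ =>
        mul_nonneg ENNReal.toReal_nonneg (Real.exp_pos _).le]
    refine Finset.sum_congr rfl fun y _ => ?_
    rw [ENNReal.ofReal_mul ENNReal.toReal_nonneg, ENNReal.ofReal_toReal (PMF.apply_ne_top _ _),
      eexpect_map, softQ, ofReal_exp_add_div, ih (h + 1) _ (by lia)]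
    simp only [ofReal_exp_add_div, eexpect_const_mul]

theorem ofReal_exp_softQ {η : ℝ} (hη : 0 < η) (h : ℕ) (x : X) (y : Y) :
    ENNReal.ofReal (Real.exp (M.softQ η h x y / η)) =
      eexpect (M.Zstar h x y) fun z => ENNReal.ofReal (Real.exp (z / η)) := by
  simp only [Zstar, eexpect_map, softQ, ofReal_exp_add_div, M.ofReal_exp_softV hη,
    eexpect_const_mul]

theorem ofReal_exp_one_sub_softQ_mul_Zstar_le_one {η : ℝ} (hη : 0 < η) (h : ℕ) (x : X) (y : Y) :
    ENNReal.ofReal (Real.exp ((1 - M.softQ η h x y) / η)) * M.Zstar h x y 1 ≤ 1 := by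
  rw [sub_div, Real.exp_sub, ENNReal.ofReal_div_of_pos (Real.exp_pos _),
    ← ENNReal.mul_div_right_comm, mul_comm]
  refine ENNReal.div_le_of_le_mul ?_
  rw [one_mul, M.ofReal_exp_softQ hη]
  exact ENNReal.le_tsum (f := fun z => M.Zstar h x y z * ENNReal.ofReal (Real.exp (z / η))) 1

end SoftBellman

section BoundedReturns

/-- The rewards-to-go under the reference policy take values in `[0, 1]`. -/
def ReturnsInUnitInterval {X Y : Type*} (M : DetMDP X Y) : Prop :=
  ∀ h < M.H, ∀ x y, (M.Zstar h x y).support ⊆ Set.Icc 0 1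

variable {X Y : Type*} {M : DetMDP X Y} {η : ℝ} {h : ℕ}

theorem ReturnsInUnitInterval.exp_div_mem_Icc (hZ : M.ReturnsInUnitInterval) (hη : 0 < η)
    (hh : h < M.H) (x : X) (y : Y) {z : ℝ} (hz : z ∈ (M.Zstar h x y).support) :
    Real.exp (z / η) ∈ Set.Icc 1 (Real.exp (1 / η)) :=
  (exp_div_mem_Icc_iff hη).2 (hZ h hh x y hz)

theorem ReturnsInUnitInterval.exp_softQ [Fintype Y] (hZ : M.ReturnsInUnitInterval)
    (hη : 0 < η) (hh : h < M.H) (x : X) (y : Y) :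
    Real.exp (M.softQ η h x y / η) = expect (M.Zstar h x y) fun z => Real.exp (z / η) := by
  have hint {z : ℝ} := hZ.exp_div_mem_Icc hη hh x y (z := z)
  refine (ENNReal.ofReal_eq_ofReal_iff (Real.exp_pos _).le
    (zero_le_one.trans (expect_mem_Icc fun z => hint).1)).1 ?_
  rw [M.ofReal_exp_softQ hη,
    ofReal_expect (.of_mem_Icc fun z => hint) fun _ _ => (Real.exp_pos _).le]

theorem ReturnsInUnitInterval.exp_softQ_mem_Icc [Fintype Y] (hZ : M.ReturnsInUnitInterval)
    (hη : 0 < η) (hh : h < M.H) (x : X) (y : Y) :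
    Real.exp (M.softQ η h x y / η) ∈ Set.Icc 1 (Real.exp (1 / η)) := by
  rw [hZ.exp_softQ hη hh]
  exact expect_mem_Icc fun z => hZ.exp_div_mem_Icc hη hh x y

theorem ReturnsInUnitInterval.softQ_mem_Icc [Fintype Y] (hZ : M.ReturnsInUnitInterval)
    (hη : 0 < η) (hh : h < M.H) (x : X) (y : Y) : M.softQ η h x y ∈ Set.Icc 0 1 :=
  (exp_div_mem_Icc_iff hη).1 (hZ.exp_softQ_mem_Icc hη hh x y)

theorem ReturnsInUnitInterval.softV_mem_Icc [Fintype Y] (hZ : M.ReturnsInUnitInterval) (hη : 0 < η)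
    (h : ℕ) (x : X) : M.softV η h x ∈ Set.Icc 0 1 := by
  rcases le_or_gt M.H h with hh | hh
  · rw [M.softV_of_le hh]
    exact Set.left_mem_Icc.2 zero_le_one
  · rw [← exp_div_mem_Icc_iff hη, M.exp_softV_of_lt hη hh, ← expect_fintype]
    exact expect_mem_Icc fun y _ => hZ.exp_softQ_mem_Icc hη hh x y

theorem ReturnsInUnitInterval.reward_mem_Icc [Finite Y] (hZ : M.ReturnsInUnitInterval)
    (hh : h < M.H) (x : X) (y : Y) : M.reward h x y ∈ Set.Icc (-1) 1 := by
  have := Fintype.ofFinite Y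
  have hQ := hZ.softQ_mem_Icc one_pos hh x y
  have hV := hZ.softV_mem_Icc one_pos (h + 1) (M.step h x y)
  rw [softQ] at hQ
  exact ⟨by linarith [hQ.1, hV.2], by linarith [hQ.2, hV.1]⟩

theorem ReturnsInUnitInterval.cv_sq_le [Fintype Y] (hZ : M.ReturnsInUnitInterval)
    (hη : 0 < η) (hh : h < M.H) (x : X) (y : Y) :
    M.cv η h x y ^ 2 ≤ Real.exp ((1 - M.softQ η h x y) / η) - 1 := by
  have hvar := variance_le_sub_expect_mul_expect fun z hz =>
    Set.Icc_subset_Icc_left zero_le_one (hZ.exp_div_mem_Icc hη hh x y hz)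
  rw [cv, div_pow, Real.sq_sqrt (variance_nonneg _ _), ← hZ.exp_softQ hη hh]
  rw [← hZ.exp_softQ hη hh] at hvar
  set m := Real.exp (M.softQ η h x y / η) with hm
  have hm0 : 0 < m := Real.exp_pos _
  calc _ ≤ (Real.exp (1 / η) - m) * m / m ^ 2 := by gcongr
    _ = Real.exp (1 / η) / m - 1 := by field_simp
    _ = _ := by rw [hm, sub_div, Real.exp_sub]

theorem ofReal_exp_one_sub_softQ_mul_le_one [Fintype Y] {p : unitInterval} (hη : 0 < η)
    {x : X} {y : Y} (hp : ENNReal.ofReal p ≤ M.Zstar h x y 1) :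
    ENNReal.ofReal (Real.exp ((1 - M.softQ η h x y) / η)) * ENNReal.ofReal p ≤ 1 :=
  (mul_le_mul_right hp _).trans (M.ofReal_exp_one_sub_softQ_mul_Zstar_le_one hη h x y)

theorem ReturnsInUnitInterval.ofReal_cv_sq_le [Finite Y] {p : unitInterval}
    (hZ : M.ReturnsInUnitInterval) (hη : 0 < η) (hh : h < M.H) {x : X} {y : Y}
    (hp : ENNReal.ofReal p ≤ M.Zstar h x y 1) :
    ENNReal.ofReal (M.cv η h x y ^ 2) ≤
      ENNReal.ofReal (1 - (p : ℝ)) / ENNReal.ofReal (p : ℝ) := by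
  have := Fintype.ofFinite Y
  have hle := ofReal_exp_one_sub_softQ_mul_le_one hη hp
  rw [← ENNReal.ofReal_mul (Real.exp_pos _).le, ENNReal.ofReal_le_one] at hle
  rw [ENNReal.le_div_iff_mul_le _ (.inl ENNReal.ofReal_ne_top),
    ← ENNReal.ofReal_mul (sq_nonneg _)]
  · refine ENNReal.ofReal_le_ofReal ?_
    linarith [mul_le_mul_of_nonneg_right (hZ.cv_sq_le hη hh x y) p.2.1]
  · by_contra! h0
    simp [(ENNReal.ofReal_eq_zero.1 h0.1).antisymm p.2.1] at h0

theorem ReturnsInUnitInterval.cvBound_le_bernoulliBound [Fintype Y] [Nonempty Y]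
    {p : ℕ → X → Y → unitInterval} (hZ : M.ReturnsInUnitInterval) (hη : 0 < η)
    (hp : ∀ h < M.H, ∀ x y, ENNReal.ofReal (p h x y) ≤ M.Zstar h x y 1)
    (β : ℝ) {K : ℕ} (π : Fin K → Policy X Y) : M.cvBound η β π ≤ M.bernoulliBound p β π := by
  unfold cvBound bernoulliBound envelope linfNorm
  gcongr with h hh k _ h hh xy _
  · exact eexpect_mono fun xy _ =>
      hZ.ofReal_cv_sq_le hη (Finset.mem_range.1 hh) (hp h (Finset.mem_range.1 hh) xy.1 xy.2)
  · rw [ENNReal.le_div_iff_mul_le (.inr one_ne_zero) (.inr ENNReal.one_ne_top)]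
    exact ofReal_exp_one_sub_softQ_mul_le_one hη (hp h (Finset.mem_range.1 hh) xy.1 xy.2)

end BoundedReturns

end DetMDP

section ExpMoment

variable {X Y : Type*} {η : ℝ} (hη : 0 < η) (Z : Model X Y) (h : ℕ) (x : X) (y : Y)

/-- The exponential moment `E_{z ∼ Z_h(x,y)} exp(z / η)` of a model. -/
noncomputable def expMoment (η : ℝ) (Z : Model X Y) (h : ℕ) (x : X) (y : Y) : ℝ :=
  expect (returnLaw Z h x y) fun z => Real.exp (z / η)

theorem support_returnLaw_subset : (returnLaw Z h x y).support ⊆ Set.Icc 0 1 := by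
  intro z hz
  rw [returnLaw, PMF.mem_support_map_iff] at hz
  obtain ⟨u, -, rfl⟩ := hz
  exact u.2

include hη

theorem exp_div_mem_Icc_of_mem_support_returnLaw {z : ℝ} (hz : z ∈ (returnLaw Z h x y).support) :
    Real.exp (z / η) ∈ Set.Icc 1 (Real.exp (1 / η)) :=
  (exp_div_mem_Icc_iff hη).2 (support_returnLaw_subset Z h x y hz)

theorem expMoment_mem_Icc : expMoment η Z h x y ∈ Set.Icc 1 (Real.exp (1 / η)) :=
  expect_mem_Icc fun _ => exp_div_mem_Icc_of_mem_support_returnLaw hη Z h x y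

theorem expMoment_pos : 0 < expMoment η Z h x y :=
  zero_lt_one.trans_le (expMoment_mem_Icc hη Z h x y).1

theorem ofReal_expMoment : ENNReal.ofReal (expMoment η Z h x y) =
    eexpect (Z h x y) fun z => ENNReal.ofReal (Real.exp ((z : ℝ) / η)) := by
  rw [expMoment, ofReal_expect (.of_mem_Icc fun _ =>
    exp_div_mem_Icc_of_mem_support_returnLaw hη Z h x y) fun _ _ => (Real.exp_pos _).le,
    returnLaw, eexpect_map]

end ExpMoment

theorem log_mem_Icc_of_mem_Icc_exp {a b : ℝ} (ha : a ∈ Set.Icc 1 (Real.exp b)) :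
    Real.log a ∈ Set.Icc 0 b :=
  ⟨Real.log_nonneg ha.1, (Real.log_le_iff_le_exp (zero_lt_one.trans_le ha.1)).2 ha.2⟩

namespace DetMDP

section TiltedPolicy

variable {X Y : Type*} (M : DetMDP X Y)

theorem support_tiltedPolicy_subset (η : ℝ) (Z : Model X Y) (h : ℕ) (x : X) :
    (M.tiltedPolicy η Z h x).support ⊆ (M.ref h x).support := by
  intro y hy
  rw [tiltedPolicy, PMF.mem_support_normalize_iff] at hy
  exact left_ne_zero_of_mul hy

theorem support_stateLaw_subset {π π' : Policy X Y}
    (hπ : ∀ h x, (π h x).support ⊆ (π' h x).support) (h : ℕ) :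
    (M.stateLaw π h).support ⊆ (M.stateLaw π' h).support := by
  induction h with
  | zero => exact subset_rfl
  | succ h ih =>
    intro x hx
    simp only [stateLaw, PMF.mem_support_bind_iff, PMF.mem_support_map_iff] at hx ⊢
    obtain ⟨x', hx', y, hy, rfl⟩ := hx
    exact ⟨x', ih hx', y, hπ h x' hy, rfl⟩

theorem mk_mem_support_stateActionLaw {π : Policy X Y} {h : ℕ} {x : X} {y : Y}
    (hx : x ∈ (M.stateLaw π h).support) (hy : y ∈ (π h x).support) :
    (x, y) ∈ (M.stateActionLaw π h).support := by
  simp only [stateActionLaw, PMF.mem_support_bind_iff, PMF.mem_support_map_iff]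
  exact ⟨x, hx, y, hy, rfl⟩

variable {η : ℝ} (hη : 0 < η) (Z : Model X Y) (h : ℕ) (x : X)

include hη

theorem tiltedPolicy_toReal (y : Y) :
    (M.tiltedPolicy η Z h x y).toReal = (M.ref h x y).toReal * expMoment η Z h x y /
      expect (M.ref h x) (expMoment η Z h x) := by
  have hw (y : Y) : (M.tiltWeight η Z h x y).toReal =
      (M.ref h x y).toReal * expMoment η Z h x y := by
    rw [tiltWeight, ENNReal.toReal_mul, ← ofReal_expMoment hη,
      ENNReal.toReal_ofReal (expMoment_pos hη Z h x y).le]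
  rw [tiltedPolicy, PMF.normalize_apply, ENNReal.toReal_mul, ENNReal.toReal_inv, hw,
    ENNReal.tsum_toReal_eq (ENNReal.ne_top_of_tsum_ne_top (M.tsum_tiltWeight_ne_top η Z h x)),
    tsum_congr hw, div_eq_mul_inv, expect]

theorem expect_expMoment_mem_Icc :
    expect (M.ref h x) (expMoment η Z h x) ∈ Set.Icc 1 (Real.exp (1 / η)) :=
  expect_mem_Icc fun y _ => expMoment_mem_Icc hη Z h x y

end TiltedPolicy

section TiltedPolicyKL

variable {X Y : Type*} [Fintype Y] (M : DetMDP X Y) {η : ℝ} (hη : 0 < η) (Z : Model X Y) (h : ℕ)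
  (x : X)

include hη

theorem kl_tiltedPolicy : kl (M.tiltedPolicy η Z h x) (M.ref h x) =
    expect (M.tiltedPolicy η Z h x) (fun y => Real.log (expMoment η Z h x y)) -
      Real.log (expect (M.ref h x) (expMoment η Z h x)) := by
  have hN : 0 < expect (M.ref h x) (expMoment η Z h x) :=
    zero_lt_one.trans_le (M.expect_expMoment_mem_Icc hη Z h x).1
  rw [kl, ← expect_fintype (M.tiltedPolicy η Z h x) fun y =>
    Real.log ((M.tiltedPolicy η Z h x y).toReal / (M.ref h x y).toReal),
    ← expect_const (M.tiltedPolicy η Z h x) (Real.log (expect _ _)),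
    ← expect_sub (.of_finite _ _) (.of_finite _ _)]
  refine expect_congr fun y hy => ?_
  have href : (M.ref h x y).toReal ≠ 0 := ENNReal.toReal_ne_zero.2
    ⟨M.support_tiltedPolicy_subset η Z h x hy, PMF.apply_ne_top _ _⟩
  rw [M.tiltedPolicy_toReal hη, div_right_comm, mul_div_cancel_left₀ _ href,
    Real.log_div (expMoment_pos hη Z h x y).ne' hN.ne']

theorem abs_kl_tiltedPolicy_le : |kl (M.tiltedPolicy η Z h x) (M.ref h x)| ≤ 1 / η := by
  have hlog : expect (M.tiltedPolicy η Z h x) (fun y => Real.log (expMoment η Z h x y)) ∈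
      Set.Icc 0 (1 / η) :=
    expect_mem_Icc fun y _ => log_mem_Icc_of_mem_Icc_exp (expMoment_mem_Icc hη Z h x y)
  have hlogN := log_mem_Icc_of_mem_Icc_exp (M.expect_expMoment_mem_Icc hη Z h x)
  rw [M.kl_tiltedPolicy hη]
  exact abs_sub_le_of_nonneg_of_le hlog.1 hlog.2 hlogN.1 hlogN.2

end TiltedPolicyKL

section StepGap

variable {X Y : Type*} [Fintype Y] {M : DetMDP X Y} {η : ℝ} {h : ℕ}

/-- The suboptimality, at the state `x`, of following `π` at step `h` only and acting optimally
from then on. -/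
noncomputable def stepGap (M : DetMDP X Y) (η : ℝ) (π : Policy X Y) (h : ℕ) (x : X) : ℝ :=
  M.softV η h x - expect (π h x) (M.softQ η h x) + η * kl (π h x) (M.ref h x)

theorem expect_reward_sub_kl (π : Policy X Y) (x : X) :
    expect (π h x) (fun y => M.reward h x y - η * kl (π h x) (M.ref h x)) =
      M.softV η h x - expect (π h x) (fun y => M.softV η (h + 1) (M.step h x y)) -
        M.stepGap η π h x := by
  have hQ : expect (π h x) (M.softQ η h x) = expect (π h x) (M.reward h x) +
      expect (π h x) fun y => M.softV η (h + 1) (M.step h x y) :=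
    expect_add (.of_finite _ _) (.of_finite _ _)
  rw [expect_sub (.of_finite _ _) (.of_finite _ _), expect_const, stepGap, hQ]
  ring

end StepGap

section PerformanceDifference

variable {X Y : Type*} [Fintype Y] {M : DetMDP X Y} {η B : ℝ} {π : Policy X Y}

theorem ReturnsInUnitInterval.stepGap_mem_Icc (hZ : M.ReturnsInUnitInterval) (hη : 0 < η)
    (hπ : ∀ h x, |kl (π h x) (M.ref h x)| ≤ B) {h : ℕ} (hh : h < M.H) (x : X) :
    M.stepGap η π h x ∈ Set.Icc (-(1 + η * B)) (1 + η * B) := by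
  have hV := hZ.softV_mem_Icc hη h x
  have hQ : expect (π h x) (M.softQ η h x) ∈ Set.Icc 0 1 :=
    expect_mem_Icc fun y _ => hZ.softQ_mem_Icc hη hh x y
  have hkl := abs_le.1 (hπ h x)
  rw [stepGap]
  constructor <;> nlinarith [hV.1, hV.2, hQ.1, hQ.2, hkl.1, hkl.2]

theorem ReturnsInUnitInterval.expect_stateActionLaw_reward_sub_kl
    (hZ : M.ReturnsInUnitInterval) (hη : 0 < η)
    (hπ : ∀ h x, |kl (π h x) (M.ref h x)| ≤ B) {h : ℕ} (hh : h < M.H) :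
    expect (M.stateActionLaw π h)
        (fun xy => M.reward h xy.1 xy.2 - η * kl (π h xy.1) (M.ref h xy.1)) =
      expect (M.stateLaw π h) (M.softV η h) - expect (M.stateLaw π (h + 1)) (M.softV η (h + 1)) -
        expect (M.stateLaw π h) (M.stepGap η π h) := by
  have hr (μ : PMF (X × Y)) : HasExpectation μ fun xy =>
      M.reward h xy.1 xy.2 - η * kl (π h xy.1) (M.ref h xy.1) := by
    refine .sub (.of_mem_Icc fun xy _ => hZ.reward_mem_Icc hh xy.1 xy.2) (.const_mul η ?_)
    exact .of_abs_le fun xy _ => hπ h xy.1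
  have hV (μ : PMF X) (t : ℕ) : HasExpectation μ (M.softV η t) :=
    .of_mem_Icc fun x _ => hZ.softV_mem_Icc hη t x
  have hnext : HasExpectation (M.stateLaw π h) fun x =>
      expect ((π h x).map (M.step h x)) (M.softV η (h + 1)) :=
    .of_mem_Icc fun x _ => expect_mem_Icc fun x' _ => hZ.softV_mem_Icc hη (h + 1) x'
  have hgap : HasExpectation (M.stateLaw π h) (M.stepGap η π h) :=
    .of_mem_Icc fun x _ => hZ.stepGap_mem_Icc hη hπ hh x
  rw [stateActionLaw, expect_bind (hr _), stateLaw, expect_bind (hV _ _),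
    ← expect_sub (hV _ _) hnext, ← expect_sub ((hV _ _).sub hnext) hgap]
  refine expect_congr fun x _ => ?_
  rw [expect_map (hr _), expect_map (hV _ _), expect_reward_sub_kl]

theorem ReturnsInUnitInterval.optValue_sub_value (hZ : M.ReturnsInUnitInterval) (hη : 0 < η)
    (hπ : ∀ h x, |kl (π h x) (M.ref h x)| ≤ B) :
    M.optValue η - M.value η π =
      ∑ h ∈ Finset.range M.H, expect (M.stateLaw π h) (M.stepGap η π h) := by
  have hend : expect (M.stateLaw π M.H) (M.softV η M.H) = 0 := by
    rw [funext (M.softV_of_le le_rfl), expect_const]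
  have hvalue : M.value η π = M.optValue η -
      ∑ h ∈ Finset.range M.H, expect (M.stateLaw π h) (M.stepGap η π h) := by
    rw [value, Finset.sum_congr rfl fun h hh =>
      hZ.expect_stateActionLaw_reward_sub_kl hη hπ (Finset.mem_range.1 hh),
      Finset.sum_sub_distrib, Finset.sum_range_sub' fun h => expect (M.stateLaw π h) (M.softV η h),
      hend, sub_zero, optValue, stateLaw]
  rw [hvalue, sub_sub_cancel]

end PerformanceDifference

section TiltError

variable {X Y : Type*} [Fintype Y] {M : DetMDP X Y} {η : ℝ} {h : ℕ}

/-- The relative error of the exponential moment of the model `Z`, of which the true value is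
`exp (Q^{⋆,η}_h(x, y) / η)`. -/
noncomputable def tiltError (M : DetMDP X Y) (η : ℝ) (Z : Model X Y) (h : ℕ) (x : X) (y : Y) : ℝ :=
  |expMoment η Z h x y / Real.exp (M.softQ η h x y / η) - 1|

theorem stepGap_tiltedPolicy_eq (hη : 0 < η) (Z : Model X Y) (hh : h < M.H) (x : X) :
    M.stepGap η (M.tiltedPolicy η Z) h x =
      η * (Real.log (∑ y, (M.ref h x y).toReal * Real.exp (M.softQ η h x y / η)) -
        Real.log (∑ y, (M.ref h x y).toReal * expMoment η Z h x y)) +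
      η * ∑ y, (M.tiltedPolicy η Z h x y).toReal *
        (Real.log (expMoment η Z h x y) - Real.log (Real.exp (M.softQ η h x y / η))) := by
  simp only [← expect_fintype]
  have hV : M.softV η h x =
      η * Real.log (expect (M.ref h x) fun y => Real.exp (M.softQ η h x y / η)) := by
    rw [expect_fintype, ← M.exp_softV_of_lt hη hh, Real.log_exp, mul_div_cancel₀ _ hη.ne']
  have hQ : expect (M.tiltedPolicy η Z h x) (M.softQ η h x) =
      η * expect (M.tiltedPolicy η Z h x) fun y => Real.log (Real.exp (M.softQ η h x y / η)) := by
    rw [← expect_const_mul]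
    simp only [Real.log_exp, mul_div_cancel₀ _ hη.ne']
  rw [stepGap, M.kl_tiltedPolicy hη, expect_sub (.of_finite _ _) (.of_finite _ _), hV, hQ]
  ring

theorem mul_div_sum_mul_le_indicator (μ : PMF Y) {m a : Y → ℝ} (hm : ∀ y, 0 ≤ m y)
    (ha : ∀ y, 0 ≤ a y) (y : Y) :
    (μ y).toReal * m y / (∑ y, (μ y).toReal * m y) * a y ≤ μ.support.indicator a y := by
  by_cases hy : y ∈ μ.support
  · have hw (y : Y) : 0 ≤ (μ y).toReal * m y := mul_nonneg ENNReal.toReal_nonneg (hm y)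
    rw [Set.indicator_of_mem hy]
    refine mul_le_of_le_one_left (ha y) (div_le_one_of_le₀ ?_ (Finset.sum_nonneg fun y _ => hw y))
    exact Finset.single_le_sum (fun y _ => hw y) (Finset.mem_univ y)
  · rw [Set.indicator_of_notMem hy, (μ.apply_eq_zero_iff y).2 hy, ENNReal.toReal_zero, zero_mul,
      zero_div, zero_mul]

theorem ReturnsInUnitInterval.mul_log_sum_sub_log_sum_le_tiltError (hZ : M.ReturnsInUnitInterval)
    (hη : 0 < η) (Z : Model X Y) (hh : h < M.H) (x : X) :
    η * (Real.log (∑ y, (M.ref h x y).toReal * Real.exp (M.softQ η h x y / η)) -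
      Real.log (∑ y, (M.ref h x y).toReal * expMoment η Z h x y)) ≤
      2 * max 1 η * ∑ y, (M.ref h x).support.indicator (M.tiltError η Z h x) y := by
  have hmoment (y : Y) :
      Real.exp (-(1 / η)) * Real.exp (M.softQ η h x y / η) ≤ expMoment η Z h x y := by
    refine le_trans ?_ (expMoment_mem_Icc hη Z h x y).1
    rw [Real.exp_neg]
    exact inv_mul_le_one_of_le₀ (hZ.exp_softQ_mem_Icc hη hh x y).2 (Real.exp_pos _).le
  have hpos : 0 < ∑ y, (M.ref h x y).toReal * Real.exp (M.softQ η h x y / η) := by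
    rw [← M.exp_softV_of_lt hη hh]
    exact Real.exp_pos _
  refine (mul_log_sum_sub_log_sum_le hη (fun _ => ENNReal.toReal_nonneg)
    (fun _ => Real.exp_pos _) hmoment hpos).trans ?_
  gcongr with y
  exact mul_div_sum_mul_le_indicator (m := fun y => Real.exp (M.softQ η h x y / η))
    (a := M.tiltError η Z h x) (M.ref h x) (fun _ => (Real.exp_pos _).le) (fun _ => abs_nonneg _) y

theorem ReturnsInUnitInterval.stepGap_tiltedPolicy_le (hZ : M.ReturnsInUnitInterval) (hη : 0 < η)
    (Z : Model X Y) (hh : h < M.H) (x : X) :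
    M.stepGap η (M.tiltedPolicy η Z) h x ≤
      3 * max 1 η * ∑ y, (M.ref h x).support.indicator (M.tiltError η Z h x) y := by
  have htilt (y : Y) : (M.tiltedPolicy η Z h x y).toReal *
      (Real.log (expMoment η Z h x y) - Real.log (Real.exp (M.softQ η h x y / η))) ≤
      (M.ref h x).support.indicator (M.tiltError η Z h x) y := by
    calc _ ≤ (M.tiltedPolicy η Z h x y).toReal * M.tiltError η Z h x y := by
          gcongr
          exact log_sub_log_le_abs_div_sub_one (expMoment_pos hη Z h x y) (Real.exp_pos _)
      _ ≤ _ := by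
          rw [M.tiltedPolicy_toReal hη, expect_fintype]
          exact mul_div_sum_mul_le_indicator _ (fun y => (expMoment_pos hη Z h x y).le)
            (fun _ => abs_nonneg _) y
  have hsum : 0 ≤ ∑ y, (M.ref h x).support.indicator (M.tiltError η Z h x) y :=
    Finset.sum_nonneg fun y _ => Set.indicator_nonneg (fun _ _ => abs_nonneg _) y
  rw [stepGap_tiltedPolicy_eq hη Z hh]
  calc _ ≤ 2 * max 1 η * ∑ y, (M.ref h x).support.indicator (M.tiltError η Z h x) y +
        η * ∑ y, (M.ref h x).support.indicator (M.tiltError η Z h x) y :=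
        add_le_add (hZ.mul_log_sum_sub_log_sum_le_tiltError hη Z hh x)
          (mul_le_mul_of_nonneg_left (Finset.sum_le_sum fun y _ => htilt y) hη.le)
    _ ≤ 3 * max 1 η * ∑ y, (M.ref h x).support.indicator (M.tiltError η Z h x) y := by
        rw [← add_mul]
        gcongr
        linarith [le_max_right 1 η]

theorem ReturnsInUnitInterval.ofReal_tiltError_le (hZ : M.ReturnsInUnitInterval) (hη : 0 < η)
    (Z : Model X Y) (hh : h < M.H) (x : X) (y : Y) :
    ENNReal.ofReal (M.tiltError η Z h x y) ≤
      2 * (ENNReal.ofReal (M.cv η h x y) *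
        hellingerSq (M.Zstar h x y) (returnLaw Z h x y) ^ (1 / 2 : ℝ)) +
      ENNReal.ofReal (Real.exp ((1 - M.softQ η h x y) / η)) *
        hellingerSq (M.Zstar h x y) (returnLaw Z h x y) := by
  have hIcc {a : ℝ} (ha : a ∈ Set.Icc 1 (Real.exp (1 / η))) : a ∈ Set.Icc 0 (Real.exp (1 / η)) :=
    Set.Icc_subset_Icc_left zero_le_one ha
  have hdiff := enorm_expect_sub_expect_le_variance
    (fun z hz => hIcc (hZ.exp_div_mem_Icc hη hh x y hz))
    fun z hz => hIcc (exp_div_mem_Icc_of_mem_support_returnLaw hη Z h x y hz)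
  rw [tiltError, cv, ← hZ.exp_softQ hη hh, sub_div, Real.exp_sub]
  rw [← hZ.exp_softQ hη hh, ← expMoment, Real.enorm_eq_ofReal_abs] at hdiff
  set m := Real.exp (M.softQ η h x y / η)
  have hm : 0 < m := Real.exp_pos _
  rw [div_sub_one hm.ne', abs_div, abs_of_pos hm]
  simp only [ENNReal.ofReal_div_of_pos hm]
  refine (ENNReal.div_le_div_right hdiff _).trans_eq ?_
  simp only [div_eq_mul_inv]
  ring

end TiltError

end DetMDP

section RegretDecomposition

theorem ofReal_sum_le {ι : Type*} (s : Finset ι) (f : ι → ℝ) :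
    ENNReal.ofReal (∑ i ∈ s, f i) ≤ ∑ i ∈ s, ENNReal.ofReal (f i) :=
  Finset.le_sum_of_subadditive _ ENNReal.ofReal_zero.le (fun _ _ => ENNReal.ofReal_add_le) _ _

theorem two_mul_rpow_one_half_le (a : ℝ≥0∞) :
    (2 * a) ^ (1 / 2 : ℝ) ≤ 2 * a ^ (1 / 2 : ℝ) := by
  rw [ENNReal.mul_rpow_of_nonneg _ _ one_half_pos.le]
  gcongr
  exact (ENNReal.rpow_le_rpow_of_exponent_le one_le_two one_half_lt_one.le).trans_eq
    (ENNReal.rpow_one 2)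

theorem card_mul_eexpect_uniformOfFintype {α : Type*} [Fintype α] [Nonempty α] (f : α → ℝ≥0∞) :
    Fintype.card α * eexpect (PMF.uniformOfFintype α) f = ∑ a, f a := by
  simp only [eexpect, PMF.uniformOfFintype_apply, tsum_fintype]
  rw [← Finset.mul_sum, ← mul_assoc, ENNReal.mul_inv_cancel (by simp) (by simp), one_mul]

namespace DetMDP

theorem cv_nonneg {X Y : Type*} (M : DetMDP X Y) (η : ℝ) (h : ℕ) (x : X) (y : Y) :
    0 ≤ M.cv η h x y :=
  div_nonneg (Real.sqrt_nonneg _)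
    (tsum_nonneg fun _ => mul_nonneg ENNReal.toReal_nonneg (Real.exp_pos _).le)

theorem ofReal_exp_le_envelope {X Y : Type*} [Fintype Y] (M : DetMDP X Y) (η : ℝ)
    {π : Policy X Y}
    (hπ : ∀ h x, (π h x).support ⊆ (M.ref h x).support) {h : ℕ} {x : X} {y : Y}
    (hx : x ∈ (M.stateLaw π h).support) (hy : y ∈ (M.ref h x).support) :
    ENNReal.ofReal (Real.exp ((1 - M.softQ η h x y) / η)) ≤ M.envelope η h :=
  le_iSup₂ (f := fun (xy : X × Y) (_ : xy ∈ (M.stateActionLaw M.ref h).support) =>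
    ENNReal.ofReal (Real.exp ((1 - M.softQ η h xy.1 xy.2) / η))) (x, y)
    (M.mk_mem_support_stateActionLaw (M.support_stateLaw_subset hπ h hx) hy)

variable {X Y : Type*} [Fintype Y] [Nonempty Y] {M : DetMDP X Y} {η : ℝ}

theorem card_mul_eexpect_rollInUnifLaw (π : Policy X Y) (h : ℕ) (f : X × Y → ℝ≥0∞) :
    Fintype.card Y * eexpect (M.rollInUnifLaw π h) f =
      eexpect (M.stateLaw π h) fun x => ∑ y, f (x, y) := by
  rw [rollInUnifLaw, eexpect_bind, ← eexpect_const_mul]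
  simp only [eexpect_map, card_mul_eexpect_uniformOfFintype]

/-- The leading term of the one-step regret: the mean, over the data of step `h`, of the product of
the coefficient of variation and the Hellinger error of the model `Z`. -/
noncomputable def cvError (M : DetMDP X Y) (η : ℝ) (π : Policy X Y) (Z : Model X Y) (h : ℕ) :
    ℝ≥0∞ :=
  eexpect (M.rollInUnifLaw π h) fun xy => ENNReal.ofReal (M.cv η h xy.1 xy.2) *
    hellingerSq (M.Zstar h xy.1 xy.2) (returnLaw Z h xy.1 xy.2) ^ (1 / 2 : ℝ)

theorem cvError_le (π : Policy X Y) (Z : Model X Y) (h : ℕ) :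
    M.cvError η π Z h ≤
      (eexpect (M.rollInUnifLaw π h) fun xy => ENNReal.ofReal (M.cv η h xy.1 xy.2 ^ 2)) ^
        (1 / 2 : ℝ) * M.modelError π Z h ^ (1 / 2 : ℝ) := by
  refine (eexpect_mul_le_rpow_mul_rpow _ _ _).trans_eq ?_
  simp only [← ENNReal.ofReal_pow (M.cv_nonneg _ _ _ _), ← ENNReal.rpow_two, ← ENNReal.rpow_mul,
    div_mul_cancel₀ (1 : ℝ) two_ne_zero, ENNReal.rpow_one]
  rfl

theorem sum_cvError_le {K : ℕ} (π : Fin K → Policy X Y) (Z : Fin K → Model X Y) :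
    ∑ k, ∑ h : Fin M.H, M.cvError η (π k) (Z k) h ≤
      (∑ h ∈ Finset.range M.H, ∑ k, eexpect (M.rollInUnifLaw (π k) h) fun xy =>
        ENNReal.ofReal (M.cv η h xy.1 xy.2 ^ 2)) ^ (1 / 2 : ℝ) *
      (∑ k, ∑ h : Fin M.H, M.modelError (π k) (Z k) h) ^ (1 / 2 : ℝ) := by
  rw [Finset.sum_range, Finset.sum_comm (s := (Finset.univ : Finset (Fin M.H)))]
  simp only [← Finset.sum_product']
  exact (Finset.sum_le_sum fun i _ => cvError_le _ _ _).trans (sum_rpow_mul_rpow_le _ _ _)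

theorem ReturnsInUnitInterval.ofReal_expect_stepGap_le (hZ : M.ReturnsInUnitInterval)
    (hη : 0 < η) (Z : Model X Y) {h : ℕ} (hh : h < M.H) :
    ENNReal.ofReal (expect (M.stateLaw (M.tiltedPolicy η Z) h)
      (M.stepGap η (M.tiltedPolicy η Z) h)) ≤
      ENNReal.ofReal (3 * max 1 η) * (Fintype.card Y *
        (2 * M.cvError η (M.tiltedPolicy η Z) Z h +
          M.envelope η h * M.modelError (M.tiltedPolicy η Z) Z h)) := by
  have hsupp := M.support_tiltedPolicy_subset η Z
  have hind (x : X) (y : Y) : 0 ≤ (M.ref h x).support.indicator (M.tiltError η Z h x) y :=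
    Set.indicator_nonneg (fun _ _ => abs_nonneg _) y
  rw [cvError, modelError, ← eexpect_const_mul, ← eexpect_const_mul, ← eexpect_add,
    card_mul_eexpect_rollInUnifLaw, ← eexpect_const_mul]
  refine (ofReal_expect_le (.of_mem_Icc fun x _ =>
    hZ.stepGap_mem_Icc hη (M.abs_kl_tiltedPolicy_le hη Z) hh x)).trans
      (eexpect_mono fun x hx => ?_)
  refine (ENNReal.ofReal_le_ofReal (hZ.stepGap_tiltedPolicy_le hη Z hh x)).trans ?_
  rw [ENNReal.ofReal_mul (by positivity), ENNReal.ofReal_sum_of_nonneg fun y _ => hind x y]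
  gcongr with y
  by_cases hy : y ∈ (M.ref h x).support
  · rw [Set.indicator_of_mem hy]
    refine (hZ.ofReal_tiltError_le hη Z hh x y).trans ?_
    gcongr
    exact M.ofReal_exp_le_envelope η hsupp hx hy
  · rw [Set.indicator_of_notMem hy, ENNReal.ofReal_zero]
    exact zero_le

theorem ReturnsInUnitInterval.ofReal_sum_regret_le_errors (hZ : M.ReturnsInUnitInterval)
    (hη : 0 < η) {K : ℕ} (Z : Fin K → Model X Y) :
    ENNReal.ofReal (∑ k, (M.optValue η - M.value η (M.tiltedPolicy η (Z k)))) ≤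
      ENNReal.ofReal (3 * max 1 η) * (Fintype.card Y *
        (2 * ∑ k, ∑ h : Fin M.H, M.cvError η (M.tiltedPolicy η (Z k)) (Z k) h +
          (⨆ h ∈ Finset.range M.H, M.envelope η h) *
            ∑ k, ∑ h : Fin M.H, M.modelError (M.tiltedPolicy η (Z k)) (Z k) h)) := by
  simp only [Finset.mul_sum, ← Finset.sum_add_distrib]
  refine (ofReal_sum_le _ _).trans (Finset.sum_le_sum fun k _ => ?_)
  rw [hZ.optValue_sub_value hη (M.abs_kl_tiltedPolicy_le hη (Z k)), Finset.sum_range]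
  refine (ofReal_sum_le _ _).trans (Finset.sum_le_sum fun h _ => ?_)
  refine (hZ.ofReal_expect_stepGap_le hη (Z k) h.2).trans ?_
  gcongr
  exact le_iSup₂ (f := fun (t : ℕ) (_ : t ∈ Finset.range M.H) => M.envelope η t) (h : ℕ)
    (Finset.mem_range.2 h.2)

theorem ReturnsInUnitInterval.ofReal_sum_regret_le (hZ : M.ReturnsInUnitInterval) (hη : 0 < η)
    {β : ℝ} {K : ℕ} (Z : Fin K → Model X Y)
    (hβ : ∑ k, ∑ h : Fin M.H, M.modelError (M.tiltedPolicy η (Z k)) (Z k) h ≤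
      2 * ENNReal.ofReal β) :
    ENNReal.ofReal (∑ k, (M.optValue η - M.value η (M.tiltedPolicy η (Z k)))) ≤
      ENNReal.ofReal (12 * max 1 η) * M.cvBound η β fun k => M.tiltedPolicy η (Z k) := by
  set E := ⨆ h ∈ Finset.range M.H, M.envelope η h with hE
  set V := ∑ h ∈ Finset.range M.H, ∑ k, eexpect (M.rollInUnifLaw (M.tiltedPolicy η (Z k)) h)
    fun xy => ENNReal.ofReal (M.cv η h xy.1 xy.2 ^ 2) with hV
  have hcv : ∑ k, ∑ h : Fin M.H, M.cvError η (M.tiltedPolicy η (Z k)) (Z k) h ≤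
      V ^ (1 / 2 : ℝ) * (2 * ENNReal.ofReal β ^ (1 / 2 : ℝ)) := by
    refine (sum_cvError_le _ _).trans (mul_le_mul_right ?_ _)
    exact (ENNReal.rpow_le_rpow hβ one_half_pos.le).trans (two_mul_rpow_one_half_le _)
  calc _ ≤ ENNReal.ofReal (3 * max 1 η) * (Fintype.card Y *
          (2 * (V ^ (1 / 2 : ℝ) * (2 * ENNReal.ofReal β ^ (1 / 2 : ℝ))) +
            E * (2 * ENNReal.ofReal β))) := by
        refine (hZ.ofReal_sum_regret_le_errors hη Z).trans ?_
        gcongr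
    _ ≤ ENNReal.ofReal (3 * max 1 η) * (Fintype.card Y *
          (2 * (V ^ (1 / 2 : ℝ) * (2 * ENNReal.ofReal β ^ (1 / 2 : ℝ))) +
            E * (4 * ENNReal.ofReal β))) := by
        gcongr
        norm_num
    _ = 4 * ENNReal.ofReal (3 * max 1 η) * M.cvBound η β fun k => M.tiltedPolicy η (Z k) := by
        rw [cvBound, ← hE, ← hV, ENNReal.mul_rpow_of_nonneg _ _ one_half_pos.le]
        ring
    _ = _ := by
        rw [← ENNReal.ofReal_ofNat, ← ENNReal.ofReal_mul zero_le_four, ← mul_assoc]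
        norm_num

end DetMDP

end RegretDecomposition

section Bernoulli

variable {μ : PMF ℝ} {p : unitInterval}

theorem apply_one_of_toMeasure_eq_bernoulliMeasure
    (hμ : μ.toMeasure = ProbabilityTheory.bernoulliMeasure 1 0 p) : μ 1 = ENNReal.ofReal p := by
  rw [← μ.toMeasure_apply_singleton 1 (measurableSet_singleton 1), hμ,
    ← MeasureTheory.ofReal_measureReal,
    ProbabilityTheory.bernoulliMeasure_real_apply p (measurableSet_singleton 1)]
  simp

theorem support_subset_of_toMeasure_eq_bernoulliMeasure
    (hμ : μ.toMeasure = ProbabilityTheory.bernoulliMeasure 1 0 p) : μ.support ⊆ {0, 1} := by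
  intro z hz
  contrapose! hz
  simp only [Set.mem_insert_iff, Set.mem_singleton_iff, not_or, eq_comm (a := z)] at hz
  rw [← PMF.apply_eq_zero_iff, ← μ.toMeasure_apply_singleton z (measurableSet_singleton z), hμ,
    ← MeasureTheory.ofReal_measureReal,
    ProbabilityTheory.bernoulliMeasure_real_apply p (measurableSet_singleton z)]
  simp [hz]

end Bernoulli

end QSharp

theorem mainTheorem4_general {X Y : Type*} [Fintype Y] [Nonempty Y] (M : QSharp.DetMDP X Y)
    {p : ℕ → X → Y → unitInterval} {F : Set (QSharp.Model X Y)} {K : ℕ} {Reg : ℝ} {O : M.Oracle}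
    {η δ : ℝ} (hZ : M.ReturnsInUnitInterval)
    (hp : ∀ h < M.H, ∀ x y, ENNReal.ofReal (p h x y) ≤ M.Zstar h x y 1)
    (hO : M.IsMLEOracle F K Reg O) (hη : 0 < η) (hδ : 0 < δ) :
    ENNReal.ofReal (1 - δ) ≤ (M.runLaw η O K).toOuterMeasure
      {run : Fin K → M.Iteration |
        ENNReal.ofReal (∑ k, (M.optValue η - M.value η (M.tiltedPolicy η (run k).1))) ≤
            ENNReal.ofReal (12 * max 1 η) *
              M.cvBound η (Real.log (1 / δ) + Reg) (fun k => M.tiltedPolicy η (run k).1) ∧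
        ENNReal.ofReal (12 * max 1 η) *
            M.cvBound η (Real.log (1 / δ) + Reg) (fun k => M.tiltedPolicy η (run k).1) ≤
          ENNReal.ofReal (12 * max 1 η) *
            M.bernoulliBound p (Real.log (1 / δ) + Reg)
              (fun k => M.tiltedPolicy η (run k).1)} := by
  have hβ : ENNReal.ofReal (2 * Real.log (1 / δ) + Reg) ≤
      2 * ENNReal.ofReal (Real.log (1 / δ) + Reg) := by
    rw [← ENNReal.ofReal_ofNat, ← ENNReal.ofReal_mul zero_le_two]
    exact ENNReal.ofReal_le_ofReal (by linarith [hO.regret_nonneg])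
  refine (hO.one_sub_le_toOuterMeasure_sum_modelError_le η hδ).trans
    (PMF.toOuterMeasure_mono _ fun run ⟨hrun, _⟩ => ⟨?_, ?_⟩)
  · exact hZ.ofReal_sum_regret_le hη _ (hrun.trans hβ)
  · exact mul_le_mul_right (hZ.cvBound_le_bernoulliBound hη hp _ _) _

theorem mainTheorem4 :
    ∃ C : ℝ≥0, ∀ (X : Type*) (Y : Type*) [Fintype Y] [Nonempty Y]
      (M : QSharp.DetMDP X Y) (p : ℕ → X → Y → unitInterval)
      (F : Set (QSharp.Model X Y)) (K : ℕ) (Reg : ℝ) (O : M.Oracle) (η δ : ℝ),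
      (∀ h < M.H, ∀ x y,
        (M.Zstar h x y).toMeasure = ProbabilityTheory.bernoulliMeasure 1 0 (p h x y)) →
      M.Realizable F →
      M.IsMLEOracle F K Reg O →
      0 < η → η ≤ 1 → 0 < δ → δ < 1 →
      ENNReal.ofReal (1 - δ) ≤ (M.runLaw η O K).toOuterMeasure
        {run : Fin K → M.Iteration |
          ENNReal.ofReal (∑ k, (M.optValue η - M.value η (M.tiltedPolicy η (run k).1))) ≤
              C * M.cvBound η (Real.log (1 / δ) + Reg) (fun k => M.tiltedPolicy η (run k).1) ∧
          C * M.cvBound η (Real.log (1 / δ) + Reg) (fun k => M.tiltedPolicy η (run k).1) ≤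
              C * M.bernoulliBound p (Real.log (1 / δ) + Reg)
                (fun k => M.tiltedPolicy η (run k).1)} := by
  refine ⟨12, fun X Y _ _ M p F K Reg O η δ hB _ hO hη hη1 hδ _ => ?_⟩
  have hZ : M.ReturnsInUnitInterval := fun h hh x y =>
    (QSharp.support_subset_of_toMeasure_eq_bernoulliMeasure (hB h hh x y)).trans
      (Set.pair_subset (Set.left_mem_Icc.2 zero_le_one) (Set.right_mem_Icc.2 zero_le_one))
  have hp : ∀ h < M.H, ∀ x y, ENNReal.ofReal (p h x y) ≤ M.Zstar h x y 1 := fun h hh x y =>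
    (QSharp.apply_one_of_toMeasure_eq_bernoulliMeasure (hB h hh x y)).ge
  simpa [max_eq_left hη1] using mainTheorem4_general M hZ hp hO hη hδ
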